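/- For an odd integer $k\ge 1$ and an even integer $\ell\ge 2$, let $H_{k,\ell}$ be the graph with vertex set $\{x_{i,j}: 1\le i\le k,\ 1\le j\le \ell\}$, where $x_{k,1}=x_{k,3}=\cdots=x_{k,\ell-1}$ is one vertex $u$ and $x_{1,2}=x_{1,4}=\cdots=x_{1,\ell}$ is one vertex $v$, but all the other vertices are distinct, and with edge set $$\{x_{i,j}x_{i,j+1}: 1\le i\le k,\ 1\le j\le \ell-1\}\cup\{x_{2i-1,j}x_{2i,j}: 1\le i\le k/2,\ 1\le j\le \ell,\ j \text{ odd}\}\cup\{x_{2i,j}x_{2i+1,j}: 1\le i\le k/2,\ 1\le j\le \ell,\ j\text{ even}\}.$$ Let $\mathrm{ex}(n,H)$ be the maximum number of edges of an $n$-vertex graph that does not contain $H$ as a (not necessarily induced) subgraph. Then for every odd $k\ge 1$ and even $\ell\ge 2$, as $n\to\infty$, $$\mathrm{ex}(n,H_{k,\ell})=O_{k,\ell}(n^{4/3}),$$ and if moreover $k\ge 3$ and $\ell\ge 4$, then $$\mathrm{ex}(n,H_{k,\ell})=\Theta_{k,\ell}(n^{4/3}).$$ -/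

import Mathlib

open Filter Asymptotics

/-- The index pairs `(i, j)` with `1 ≤ i ≤ k` and `1 ≤ j ≤ ℓ`. -/
abbrev HoneycombIndex (k ℓ : ℕ) : Type :=
  {p : ℕ × ℕ // p ∈ Finset.Icc 1 k ×ˢ Finset.Icc 1 ℓ}

/-- The identifications among the labels `x_{i,j}`: all `x_{k,j}` with `j` odd are one vertex `u`,
all `x_{1,j}` with `j` even are one vertex `v`, and there are no other identifications. -/
def honeycombSetoid (k ℓ : ℕ) : Setoid (HoneycombIndex k ℓ) where
  r p q := p = q ∨
    (p.1.1 = k ∧ Odd p.1.2 ∧ q.1.1 = k ∧ Odd q.1.2) ∨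
    (p.1.1 = 1 ∧ Even p.1.2 ∧ q.1.1 = 1 ∧ Even q.1.2)
  iseqv := by
    refine ⟨fun p => Or.inl rfl, fun {p q} h => ?_, fun {p q r} h h' => ?_⟩
    · grind
    · grind

/-- The vertex set of `H_{k,ℓ}`. -/
def HoneycombVertex (k ℓ : ℕ) : Type := Quotient (honeycombSetoid k ℓ)

/-- The edges of `H_{k,ℓ}` on the level of labels, each in one orientation:
`x_{i,j} x_{i,j+1}`; `x_{2i-1,j} x_{2i,j}` for `j` odd; `x_{2i,j} x_{2i+1,j}` for `j` even. -/
def honeycombEdge (k ℓ : ℕ) (p q : HoneycombIndex k ℓ) : Prop :=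
  (q.1.1 = p.1.1 ∧ q.1.2 = p.1.2 + 1) ∨
  (q.1.1 = p.1.1 + 1 ∧ q.1.2 = p.1.2 ∧ Odd p.1.1 ∧ Odd p.1.2) ∨
  (q.1.1 = p.1.1 + 1 ∧ q.1.2 = p.1.2 ∧ Even p.1.1 ∧ Even p.1.2)

/-- The honeycomb graph `H_{k,ℓ}` (intended for odd `k` and even `ℓ`). -/
def honeycombGraph (k ℓ : ℕ) : SimpleGraph (HoneycombVertex k ℓ) :=
  SimpleGraph.fromRel fun a b =>
    ∃ p q : HoneycombIndex k ℓ, honeycombEdge k ℓ p q ∧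
      Quotient.mk (honeycombSetoid k ℓ) p = a ∧ Quotient.mk (honeycombSetoid k ℓ) q = b

/-! Upper bound. For each `m`, columns `2m - 1` and `2m` of the honeycomb form a path that snakes
from `v` to `u`, and the remaining edges join consecutive snakes crosswise. Write such a path as `x₀
z₁ x₁ z₂ x₂ … z_k` and group it into states `(z_j, x_j)`. Suppose a walk lies in a family in which
any interior state can be exchanged for one avoiding a prescribed bounded set of vertices.
Exchanging the odd states and then the even ones gives a walk with the same ends and new interior
vertices, and the hybrid walk in between supplies exactly the cross edges. Iterating this builds the
honeycomb (`honeycombGraph_isContained_of_isReplaceable`).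

A replaceable family is found among the trajectories of a stationary Markov chain on states
(`exists_robust_chain`): trajectories whose state at some position has only few alternatives are
deleted, and stationarity bounds the deleted mass. It suffices that no single vertex carries much of
the probability of filling a hole between two states (`honeycombGraph_isContained_of_chain`).

After passing to minimum degree `δ`, of order at least `n ^ (1/3)`, two chains are available. Call a
pair heavy if its codegree exceeds `L / δ` times the larger degree. If around every vertex few pairs
of neighbours are heavy, simple random walk works, with a loss proportional to `n / δ ^ 3`; this is
the source of the exponent `4/3`. Otherwise some neighbourhood contains a set `Y` in which every
vertex forms heavy pairs with a positive proportion of a degree; the chain then walks along heavy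
pairs inside `Y` through random common neighbours, and large `L` makes the loss small.

Lower bound. For `k ≥ 3` and `ℓ ≥ 4` the honeycomb contains a hexagon, and an algebraic incidence
graph over a prime field has `2 q ^ 3` vertices, at least `q ^ 4` edges and no hexagon. -/

/-! ### Robust families of trajectories of a stationary Markov chain. -/

/-- Robust subfamilies by deletion: if all the bad parts of the fibres of finitely many maps
together weigh less than the family, then some nonempty subfamily has no bad fibre. -/
theorem exists_subfamily_without_bad_fibers {Ω I : Type*} [Fintype Ω] [DecidableEq Ω] [Fintype I]
    (w : Ω → ℝ) (F₀ : Finset Ω) (p : I → Ω → Ω) (Bad : I → Finset Ω → Prop) (β : I → Ω → ℝ)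
    (hβ0 : ∀ i q, 0 ≤ β i q)
    (hβ : ∀ i q, ∀ T ⊆ F₀, (∀ s ∈ T, p i s = q) → Bad i T → ∑ s ∈ T, w s ≤ β i q)
    (hsum : ∑ i, ∑ q, β i q < ∑ s ∈ F₀, w s) :
    ∃ F ⊆ F₀, F.Nonempty ∧ ∀ i, ∀ s ∈ F, ¬ Bad i (F.filter fun t => p i t = p i s) := by
  classical
  -- The potential is the total budget of the fibres that still meet the family. Deleting a bad
  -- fibre costs weight at most `β` and releases exactly that budget, so the inequality defining `S`
  -- survives; a smallest member of `S` therefore has no bad fibre.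
  let pot : Finset Ω → ℝ := fun F => ∑ i, ∑ q ∈ F.image (p i), β i q
  let S : Finset (Finset Ω) := F₀.powerset.filter fun F => pot F < ∑ s ∈ F, w s
  have hS : S.Nonempty := by
    refine ⟨F₀, ?_⟩
    simp only [S, Finset.mem_filter, Finset.mem_powerset, subset_rfl, true_and]
    refine lt_of_le_of_lt ?_ hsum
    exact Finset.sum_le_sum fun i _ =>
      Finset.sum_le_univ_sum_of_nonneg (hβ0 i)
  obtain ⟨F, hFS, hmin⟩ := S.exists_min_image Finset.card hS
  simp only [S, Finset.mem_filter, Finset.mem_powerset] at hFS hmin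
  have hpot0 : 0 ≤ pot F := Finset.sum_nonneg fun i _ => Finset.sum_nonneg fun q _ => hβ0 i q
  refine ⟨F, hFS.1, ?_, ?_⟩
  · rcases F.eq_empty_or_nonempty with h | h
    · have := hFS.2
      rw [h] at this hpot0
      simp only [Finset.sum_empty] at this
      linarith
    · exact h
  · intro i s hs hbad
    set T := F.filter fun t => p i t = p i s with hT
    have hTF : T ⊆ F := Finset.filter_subset _ _
    have hsT : s ∈ T := by simp [hT, hs]
    have hw : ∑ t ∈ T, w t ≤ β i (p i s) :=
      hβ i _ T (hTF.trans hFS.1) (fun t ht => (Finset.mem_filter.1 ht).2) hbad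
    have hsd : ∑ t ∈ F \ T, w t + ∑ t ∈ T, w t = ∑ t ∈ F, w t := Finset.sum_sdiff hTF
    have hle : pot (F \ T) + β i (p i s) ≤ pot F := by
      have h1 : ∀ j, ∑ q ∈ (F \ T).image (p j), β j q ≤ ∑ q ∈ F.image (p j), β j q := fun j =>
        Finset.sum_le_sum_of_subset_of_nonneg (Finset.image_subset_image Finset.sdiff_subset)
          fun q _ _ => hβ0 j q
      have h2 : ∑ q ∈ (F \ T).image (p i), β i q + β i (p i s) ≤ ∑ q ∈ F.image (p i), β i q := by
        have hnot : p i s ∉ (F \ T).image (p i) := by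
          simp only [Finset.mem_image, Finset.mem_sdiff, hT, Finset.mem_filter, not_exists, not_and]
          intro t ht h
          exact ht.2 ht.1 h
        rw [add_comm, ← Finset.sum_insert hnot]
        refine Finset.sum_le_sum_of_subset_of_nonneg ?_ fun q _ _ => hβ0 i q
        intro q hq
        rcases Finset.mem_insert.1 hq with rfl | hq
        · exact Finset.mem_image_of_mem _ hs
        · exact Finset.image_subset_image Finset.sdiff_subset hq
      simp only [pot]
      rw [← Finset.add_sum_erase _ _ (Finset.mem_univ i),
        ← Finset.add_sum_erase (a := i) _ (fun j => ∑ q ∈ F.image (p j), β j q) (Finset.mem_univ i)]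
      have := Finset.sum_le_sum fun j (_ : j ∈ Finset.univ.erase i) => h1 j
      linarith
    have := hmin (F \ T) ⟨Finset.sdiff_subset.trans hFS.1, by linarith [hFS.2]⟩
    have hlt : (F \ T).card < F.card :=
      Finset.card_lt_card (Finset.sdiff_ssubset hTF ⟨s, hsT⟩)
    omega

/-- The distribution after `n` steps of a chain with initial weights `f` and kernels `K j`. -/
def chainMass {σ : Type*} [Fintype σ] (f : σ → ℝ) (K : ℕ → σ → σ → ℝ) : ℕ → σ → ℝ
  | 0 => f
  | n + 1 => fun y => ∑ x, chainMass f K n x * K n x y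

/-- Sums out the last coordinate: the test function `g` is general so that the induction can absorb
the last kernel into it. The kernels may vary with the step, which lets single steps be altered
below. -/
theorem sum_chain {σ : Type*} [Fintype σ] (f : σ → ℝ) (K : ℕ → σ → σ → ℝ) (n : ℕ) (g : σ → ℝ) :
    ∑ s : Fin (n + 1) → σ, f (s 0) * (∏ j : Fin n, K j (s j.castSucc) (s j.succ)) * g (s (Fin.last n))
      = ∑ x, chainMass f K n x * g x := by
  induction n generalizing g with
  | zero =>
    rw [← (Equiv.funUnique (Fin 1) σ).symm.sum_comp]
    simp [chainMass]
  | succ n ih =>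
    rw [← (Fin.snocEquiv fun _ : Fin (n + 2) => σ).sum_comp, Fintype.sum_prod_type_right]
    simp only [chainMass, Finset.sum_mul]
    conv_rhs => rw [Finset.sum_comm]
    have := ih fun x => ∑ y, K n x y * g y
    simp only [Finset.mul_sum] at this
    simp only [mul_assoc] at this ⊢
    rw [← this]
    refine Finset.sum_congr rfl fun s _ => Finset.sum_congr rfl fun y _ => ?_
    simp only [Fin.snocEquiv_apply, Fin.prod_univ_castSucc, Fin.snoc_castSucc, Fin.snoc_last,
      Fin.succ_last, Fin.val_castSucc, Fin.val_last, ← Fin.castSucc_zero, Fin.succ_castSucc]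
    ring

theorem chainMass_nonneg {σ : Type*} [Fintype σ] {f : σ → ℝ} {K : ℕ → σ → σ → ℝ}
    (hf : ∀ x, 0 ≤ f x) (hK : ∀ j x y, 0 ≤ K j x y) (n : ℕ) (x : σ) : 0 ≤ chainMass f K n x := by
  induction n generalizing x with
  | zero => exact hf x
  | succ n ih => exact Finset.sum_nonneg fun y _ => mul_nonneg (ih y) (hK n y x)

theorem chainMass_eq_of_stationary {σ : Type*} [Fintype σ] {f : σ → ℝ} {K : ℕ → σ → σ → ℝ} {n : ℕ}
    (h : ∀ j < n, ∀ y, ∑ x, f x * K j x y = f y) : chainMass f K n = f := by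
  induction n with
  | zero => rfl
  | succ n ih =>
    funext y
    simp only [chainMass]
    rw [ih fun j hj => h j (by omega)]
    exact h n (by omega) y

theorem sum_chainMass_le {σ : Type*} [Fintype σ] {f : σ → ℝ} {K : ℕ → σ → σ → ℝ} {m n : ℕ}
    (hf : ∀ x, 0 ≤ f x) (hK : ∀ j x y, 0 ≤ K j x y) (hmn : m ≤ n)
    (h : ∀ j, m ≤ j → ∀ x, ∑ y, K j x y ≤ 1) :
    ∑ x, chainMass f K n x ≤ ∑ x, chainMass f K m x := by
  induction n, hmn using Nat.le_induction with
  | base => exact le_rfl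
  | succ n hmn ih =>
    refine le_trans ?_ ih
    simp only [chainMass]
    rw [Finset.sum_comm]
    refine Finset.sum_le_sum fun x _ => ?_
    rw [← Finset.mul_sum]
    exact mul_le_of_le_one_right (chainMass_nonneg hf hK n x) (h n hmn x)

theorem prod_univ_eq_mul_mul_prod_erase {ι : Type*} [Fintype ι] [DecidableEq ι] (g : ι → ℝ)
    {i j : ι} (h : j ≠ i) :
    ∏ l, g l = g i * g j * ∏ l ∈ (Finset.univ.erase i).erase j, g l := by
  rw [mul_assoc, Finset.mul_prod_erase _ _ (by simp [h]), Finset.mul_prod_erase _ _ (by simp)]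

/-- The weight of the chains with a hole at an interior state, when a filled hole between `a` and
`c` is charged `β a c`. -/
theorem sum_hole_le {σ : Type*} [Fintype σ] [DecidableEq σ] {N : ℕ} (p : σ → ℝ) (K β : σ → σ → ℝ)
    (hp0 : ∀ x, 0 ≤ p x) (hK0 : ∀ x y, 0 ≤ K x y) (hβ0 : ∀ x y, 0 ≤ β x y)
    (hrow : ∀ x, ∑ y, K x y ≤ 1) (hstat : ∀ y, ∑ x, p x * K x y = p y) (s₀ : σ)
    (j₀ j₁ : Fin N) (hj : (j₁ : ℕ) = j₀ + 1) :
    ∑ q : Fin (N + 1) → σ, (if q j₀.succ = s₀ then p (q 0) * (β (q j₀.castSucc) (q j₁.succ) *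
        ∏ j ∈ (Finset.univ.erase j₀).erase j₁, K (q j.castSucc) (q j.succ)) else 0)
      ≤ ∑ a, ∑ c, p a * β a c := by
  have hne : j₁ ≠ j₀ := by intro h; rw [h] at hj; omega
  let Kc : σ → ℕ → σ → σ → ℝ := fun c j a b =>
    if j = j₀ then (if b = s₀ then β a c else 0) else if j = j₁ then (if b = c then 1 else 0)
    else K a b
  have hKc0 : ∀ c j a b, 0 ≤ Kc c j a b := by
    intro c j a b
    simp only [Kc]
    split_ifs <;> first | exact hβ0 _ _ | exact hK0 _ _ | norm_num
  have key : ∀ c, ∑ q : Fin (N + 1) → σ, p (q 0) * ∏ j : Fin N, Kc c j (q j.castSucc) (q j.succ)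
      ≤ ∑ a, p a * β a c := by
    intro c
    have h1 := sum_chain p (Kc c) N fun _ => 1
    simp only [mul_one] at h1
    rw [h1]
    have h2 : chainMass p (Kc c) j₀ = p := by
      refine chainMass_eq_of_stationary fun j hj' y => ?_
      have : j ≠ j₁ := by omega
      simp only [Kc, hj'.ne, this, if_false]
      exact hstat y
    have h3 : ∀ y, chainMass p (Kc c) (j₀ + 1) y = if y = s₀ then ∑ a, p a * β a c else 0 := by
      intro y
      simp only [chainMass, h2, Kc, if_true]
      split_ifs <;> simp
    have h4 : ∑ y, chainMass p (Kc c) (j₀ + 1 + 1) y = ∑ a, p a * β a c := by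
      rw [chainMass]
      simp only [h3]
      have e1 : (j₀ : ℕ) + 1 ≠ j₀ := by omega
      have e2 : (j₀ : ℕ) + 1 = j₁ := by omega
      simp [Kc, ← e2]
    rw [← h4]
    refine sum_chainMass_le hp0 (hKc0 c) (by have := j₁.2; omega) fun j hj' x => ?_
    have e1 : j ≠ j₀ := by omega
    have e2 : j ≠ j₁ := by omega
    simp only [Kc, e1, e2, if_false]
    exact hrow x
  calc _ = ∑ q : Fin (N + 1) → σ, ∑ c,
        p (q 0) * ∏ j : Fin N, Kc c j (q j.castSucc) (q j.succ) := by
        refine Finset.sum_congr rfl fun q _ => ?_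
        have : ∀ c, ∏ j : Fin N, Kc c j (q j.castSucc) (q j.succ)
            = (if q j₀.succ = s₀ then β (q j₀.castSucc) c else 0) *
              (if q j₁.succ = c then 1 else 0) *
              ∏ j ∈ (Finset.univ.erase j₀).erase j₁, K (q j.castSucc) (q j.succ) := by
          intro c
          rw [prod_univ_eq_mul_mul_prod_erase _ hne]
          congr 1
          · have : ((j₁ : ℕ)) ≠ j₀ := by omega
            simp [Kc, this]
          · refine Finset.prod_congr rfl fun j hj' => ?_
            simp only [Finset.mem_erase, Finset.mem_univ, and_true] at hj'
            have e1 : (j : ℕ) ≠ j₀ := fun h => hj'.2 (Fin.ext h)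
            have e2 : (j : ℕ) ≠ j₁ := fun h => hj'.1 (Fin.ext h)
            simp [Kc, e1, e2]
        simp only [this]
        split_ifs with h <;> simp
    _ = ∑ c, ∑ q : Fin (N + 1) → σ, p (q 0) * ∏ j : Fin N, Kc c j (q j.castSucc) (q j.succ) :=
        Finset.sum_comm
    _ ≤ ∑ c, ∑ a, p a * β a c := Finset.sum_le_sum fun c _ => key c
    _ = _ := Finset.sum_comm

/-- The chains all of whose steps are good carry almost all the weight. -/
theorem sum_good_chain_ge {σ : Type*} [Fintype σ] (N : ℕ) (p : σ → ℝ)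
    (K : σ → σ → ℝ) (good : σ → σ → Prop) [DecidableRel good] {ε : ℝ}
    (hp0 : ∀ x, 0 ≤ p x) (hK0 : ∀ x y, 0 ≤ K x y)
    (hrow : ∀ x, ∑ y, K x y ≤ 1) (hstat : ∀ y, ∑ x, p x * K x y = p y)
    (hbad : ∑ a, ∑ b, p a * (if good a b then 0 else K a b) ≤ ε * ∑ a, p a) :
    (1 - N * ε) * ∑ a, p a ≤ ∑ s : Fin (N + 1) → σ with ∀ j : Fin N, good (s j.castSucc) (s j.succ),
      p (s 0) * ∏ j : Fin N, K (s j.castSucc) (s j.succ) := by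
  classical
  set w : (Fin (N + 1) → σ) → ℝ := fun s => p (s 0) * ∏ j : Fin N, K (s j.castSucc) (s j.succ)
    with hw
  have hw0 : ∀ s, 0 ≤ w s := fun s =>
    mul_nonneg (hp0 _) (Finset.prod_nonneg fun j _ => hK0 _ _)
  have htot : ∑ s, w s = ∑ a, p a := by
    have h1 := sum_chain p (fun _ => K) N fun _ => 1
    simp only [mul_one] at h1
    rw [hw, h1, chainMass_eq_of_stationary fun j _ y => hstat y]
  have hstep : ∀ i : Fin N, ∑ s, (if good (s i.castSucc) (s i.succ) then 0 else w s)
      ≤ ε * ∑ a, p a := by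
    intro i
    -- Union bound over the steps: retaining only bad transitions at step `i`, the law before it is
    -- `p`, so the mass is bounded by `hbad`.
    let Ki : ℕ → σ → σ → ℝ := fun j a b =>
      if j = i then (if good a b then 0 else K a b) else K a b
    have hKi0 : ∀ j a b, 0 ≤ Ki j a b := by
      intro j a b
      simp only [Ki]
      split_ifs <;> first | exact hK0 _ _ | norm_num
    have h1 := sum_chain p Ki N fun _ => 1
    simp only [mul_one] at h1
    have h2 : ∀ s : Fin (N + 1) → σ, (if good (s i.castSucc) (s i.succ) then 0 else w s)
        = p (s 0) * ∏ j : Fin N, Ki j (s j.castSucc) (s j.succ) := by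
      intro s
      have e : ∀ j ∈ Finset.univ.erase i, Ki j (s j.castSucc) (s j.succ)
          = K (s j.castSucc) (s j.succ) := by
        intro j hj
        have : (j : ℕ) ≠ i := fun h => (Finset.mem_erase.1 hj).1 (Fin.ext h)
        simp [Ki, this]
      rw [← Finset.mul_prod_erase _ _ (Finset.mem_univ i), Finset.prod_congr rfl e, hw]
      simp only [← Finset.mul_prod_erase _ (fun j : Fin N => K (s j.castSucc) (s j.succ))
        (Finset.mem_univ i), Ki, if_true]
      split_ifs <;> simp
    simp only [h2]
    rw [h1]
    refine le_trans (sum_chainMass_le hp0 hKi0 (m := i + 1) (by omega) fun j hj x => ?_) ?_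
    · have : j ≠ i := by omega
      simp only [Ki, this, if_false]
      exact hrow x
    · simp only [chainMass]
      rw [chainMass_eq_of_stationary fun j hj y => by
        simp only [Ki, hj.ne, if_false]; exact hstat y, Finset.sum_comm]
      simpa [Ki] using hbad
  have hle : ∑ s, w s ≤ (∑ s with ∀ j : Fin N, good (s j.castSucc) (s j.succ), w s)
      + ∑ i : Fin N, ∑ s, (if good (s i.castSucc) (s i.succ) then 0 else w s) := by
    rw [Finset.sum_comm, Finset.sum_filter, ← Finset.sum_add_distrib]
    refine Finset.sum_le_sum fun s _ => ?_
    have hnn : ∀ i ∈ (Finset.univ : Finset (Fin N)),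
        0 ≤ (if good (s i.castSucc) (s i.succ) then 0 else w s) := by
      intro i _; split_ifs; exacts [le_rfl, hw0 s]
    split_ifs with h
    · linarith [Finset.sum_nonneg hnn]
    · push Not at h
      obtain ⟨i, hi⟩ := h
      have := Finset.single_le_sum hnn (Finset.mem_univ i)
      rw [if_neg hi] at this
      linarith
  have := Finset.sum_le_sum fun i (_ : i ∈ (Finset.univ : Finset (Fin N))) => hstep i
  rw [Finset.sum_const, Finset.card_univ, Fintype.card_fin, nsmul_eq_mul] at this
  rw [htot] at hle
  linarith

/-- A stationary chain in which no small set of states covers the ways to fill a hole has a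
nonempty family of trajectories in which every interior state can always be replaced by a state
outside a given small set. -/
theorem exists_robust_chain {σ : Type*} [Fintype σ] (N : ℕ) (p : σ → ℝ)
    (K β : σ → σ → ℝ) (good : σ → σ → Prop) (𝒞 : Set (Set σ)) {ε c : ℝ}
    (hp0 : ∀ x, 0 ≤ p x) (hK0 : ∀ x y, 0 ≤ K x y) (hβ0 : ∀ x y, 0 ≤ β x y)
    (hrow : ∀ x, ∑ y, K x y ≤ 1) (hstat : ∀ y, ∑ x, p x * K x y = p y)
    (hbad : ∀ [DecidableRel good], ∑ a, ∑ b, p a * (if good a b then 0 else K a b) ≤ ε * ∑ a, p a)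
    (hcov : ∀ C ∈ 𝒞, ∀ a d, ∀ B : Finset σ, (∀ b ∈ B, b ∈ C ∧ good a b ∧ good b d) →
      ∑ b ∈ B, K a b * K b d ≤ β a d)
    (hβ : ∑ a, ∑ d, p a * β a d ≤ c * ∑ a, p a)
    (hpos : 0 < ∑ a, p a) (hlt : (N + 1) * (ε + c) < 1) (hε : 0 ≤ ε) (hc : 0 ≤ c) :
    ∃ F : Set (Fin (N + 1) → σ), F.Nonempty ∧
      (∀ s ∈ F, ∀ j : Fin N, 0 < K (s j.castSucc) (s j.succ)) ∧
      ∀ s ∈ F, ∀ i : Fin (N + 1), 0 < i → i < Fin.last N → ∀ C ∈ 𝒞,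
        ∃ b ∉ C, Function.update s i b ∈ F := by
  classical
  obtain ⟨s₀, -⟩ : ∃ s₀ : σ, s₀ ∈ (Finset.univ : Finset σ) := by
    by_contra h
    push Not at h
    rw [Finset.sum_eq_zero fun a ha => absurd ha (h a)] at hpos
    exact lt_irrefl _ hpos
  set w : (Fin (N + 1) → σ) → ℝ := fun s => p (s 0) * ∏ j : Fin N, K (s j.castSucc) (s j.succ)
    with hw
  have hw0 : ∀ s, 0 ≤ w s := fun s =>
    mul_nonneg (hp0 _) (Finset.prod_nonneg fun j _ => hK0 _ _)
  set G : Finset (Fin (N + 1) → σ) :=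
    Finset.univ.filter fun s => ∀ j : Fin N, good (s j.castSucc) (s j.succ) with hG
  -- Trajectories of weight zero are dropped so that every transition of a surviving one has
  -- positive `K`.
  set F₀ := G.filter fun s => 0 < w s with hF₀
  have hF₀sum : ∑ s ∈ F₀, w s = ∑ s ∈ G, w s := by
    rw [hF₀, Finset.sum_filter]
    refine Finset.sum_congr rfl fun s _ => ?_
    split_ifs with h
    · rfl
    · exact le_antisymm (hw0 s) (not_lt.1 h)
  have hmass := sum_good_chain_ge N p K good hp0 hK0 hrow hstat hbad
  -- A pair of consecutive steps encloses one interior state. Overwriting that state by `s₀` makes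
  -- the fibres consist of the trajectories that differ only there; a fibre is bad if one member of
  -- `𝒞` contains all its fillings.
  let I := {i : Fin N × Fin N // (i.2 : ℕ) = i.1 + 1}
  let βI : I → (Fin (N + 1) → σ) → ℝ := fun i q =>
    if q i.1.1.succ = s₀ then p (q 0) * (β (q i.1.1.castSucc) (q i.1.2.succ) *
        ∏ j ∈ (Finset.univ.erase i.1.1).erase i.1.2, K (q j.castSucc) (q j.succ)) else 0
  have hdel : ∃ F ⊆ F₀, F.Nonempty ∧ ∀ i : I, ∀ s ∈ F, ¬ ∃ C ∈ 𝒞, ∀ t ∈ F.filter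
      (fun t => Function.update t i.1.1.succ s₀ = Function.update s i.1.1.succ s₀),
      t i.1.1.succ ∈ C := by
    refine exists_subfamily_without_bad_fibers w F₀
      (fun (i : I) s => Function.update s i.1.1.succ s₀)
      (fun i T => ∃ C ∈ 𝒞, ∀ s ∈ T, s i.1.1.succ ∈ C) βI ?_ ?_ ?_
    · intro i q
      simp only [βI]
      split_ifs
      · exact mul_nonneg (hp0 _) (mul_nonneg (hβ0 _ _) (Finset.prod_nonneg fun j _ => hK0 _ _))
      · exact le_rfl
    · rintro ⟨⟨j₀, j₁⟩, hj⟩ q T hT hq ⟨C, hC, hTC⟩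
      simp only at hj hq hTC
      have hne : j₁ ≠ j₀ := by intro h; rw [h] at hj; omega
      have hcs : j₀.succ = j₁.castSucc := by ext; simp [hj]
      have hval : ∀ s ∈ T, ∀ l, l ≠ j₀.succ → s l = q l := by
        intro s hs l hl
        rw [← hq s hs, Function.update_of_ne hl]
      rcases T.eq_empty_or_nonempty with rfl | ⟨s₁, hs₁⟩
      · simp only [Finset.sum_empty, βI]
        split_ifs
        · exact mul_nonneg (hp0 _) (mul_nonneg (hβ0 _ _) (Finset.prod_nonneg fun j _ => hK0 _ _))
        · exact le_rfl
      have hq0 : q j₀.succ = s₀ := by rw [← hq s₁ hs₁]; simp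
      simp only [βI, if_pos hq0]
      have hws : ∀ s ∈ T, w s = p (q 0) * ((K (q j₀.castSucc) (s j₀.succ) *
          K (s j₀.succ) (q j₁.succ)) *
          ∏ j ∈ (Finset.univ.erase j₀).erase j₁, K (q j.castSucc) (q j.succ)) := by
        intro s hs
        rw [hw]
        simp only
        rw [hval s hs 0 (Fin.succ_ne_zero _).symm, prod_univ_eq_mul_mul_prod_erase _ hne,
          hval s hs j₀.castSucc (by intro h; have := congrArg Fin.val h; simp at this),
          ← hcs, hval s hs j₁.succ (by
            intro h; have := congrArg Fin.val h; simp at this; omega)]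
        congr 2
        refine Finset.prod_congr rfl fun j hj' => ?_
        simp only [Finset.mem_erase, Finset.mem_univ, and_true] at hj'
        rw [hval s hs j.castSucc (by rw [hcs]; exact fun h => hj'.1 (Fin.castSucc_injective _ h)),
          hval s hs j.succ fun h => hj'.2 (Fin.succ_injective _ h)]
      rw [Finset.sum_congr rfl hws, ← Finset.mul_sum, ← Finset.sum_mul]
      refine mul_le_mul_of_nonneg_left (mul_le_mul_of_nonneg_right ?_
        (Finset.prod_nonneg fun j _ => hK0 _ _)) (hp0 _)
      have hinj : Set.InjOn (fun s : Fin (N + 1) → σ => s j₀.succ) T := by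
        intro s hs t ht h
        funext l
        by_cases hl : l = j₀.succ
        · subst hl; exact h
        · rw [hval s hs l hl, hval t ht l hl]
      have := hcov C hC (q j₀.castSucc) (q j₁.succ) (T.image fun s => s j₀.succ) ?_
      · rwa [Finset.sum_image hinj] at this
      · intro b hb
        obtain ⟨s, hs, rfl⟩ := Finset.mem_image.1 hb
        have hsg := (Finset.mem_filter.1 (Finset.mem_filter.1 (hT hs)).1).2
        refine ⟨hTC s hs, ?_, ?_⟩
        · have := hsg j₀
          rwa [hval s hs j₀.castSucc (by intro h; have := congrArg Fin.val h; simp at this)] at this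
        · have := hsg j₁
          rwa [← hcs, hval s hs j₁.succ (by
            intro h; have := congrArg Fin.val h; simp at this; omega)] at this
    · have h1 : ∀ i : I, ∑ q, βI i q ≤ c * ∑ a, p a := fun i =>
        (sum_hole_le p K β hp0 hK0 hβ0 hrow hstat s₀ i.1.1 i.1.2 i.2).trans hβ
      have hI : (Fintype.card I : ℝ) ≤ N + 1 := by
        have : Fintype.card I ≤ Fintype.card (Fin N) :=
          Fintype.card_le_of_injective (fun i : I => i.1.1) fun i j h => by
            obtain ⟨⟨i1, i2⟩, hi⟩ := i
            obtain ⟨⟨j1, j2⟩, hj⟩ := j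
            change i1 = j1 at h
            change (i2 : ℕ) = i1 + 1 at hi
            change (j2 : ℕ) = j1 + 1 at hj
            subst h
            obtain rfl : i2 = j2 := Fin.ext (by omega)
            rfl
        rw [Fintype.card_fin] at this
        have : (Fintype.card I : ℝ) ≤ N := by exact_mod_cast this
        linarith
      have h2 := Finset.sum_le_sum fun i (_ : i ∈ (Finset.univ : Finset I)) => h1 i
      rw [Finset.sum_const, Finset.card_univ, nsmul_eq_mul] at h2
      rw [hF₀sum]
      have h3 : (Fintype.card I : ℝ) * (c * ∑ a, p a) ≤ (N + 1) * (c * ∑ a, p a) :=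
        mul_le_mul_of_nonneg_right hI (mul_nonneg hc hpos.le)
      have h4 : (N : ℝ) * ε ≤ (N + 1) * ε := by linarith
      have h5 : ((N + 1) * c) * ∑ a, p a < (1 - N * ε) * ∑ a, p a := by
        refine mul_lt_mul_of_pos_right ?_ hpos
        linarith
      calc _ ≤ _ := h2
        _ ≤ _ := h3
        _ = ((N + 1) * c) * ∑ a, p a := by ring
        _ < _ := h5
        _ ≤ _ := hmass
  obtain ⟨F, hFF₀, hFne, hF⟩ := hdel
  refine ⟨F, hFne, ?_, ?_⟩
  · intro s hs j
    have h1 : 0 < w s := (Finset.mem_filter.1 (hFF₀ hs)).2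
    refine lt_of_le_of_ne (hK0 _ _) fun h => ?_
    rw [hw] at h1
    simp only at h1
    rw [Finset.prod_eq_zero (Finset.mem_univ j) h.symm, mul_zero] at h1
    exact lt_irrefl _ h1
  · intro s hs i hi0 hiN C hC
    have hi0' : 0 < (i : ℕ) := Fin.val_pos_iff.2 hi0
    have hiN' : (i : ℕ) < N := Fin.lt_def.1 hiN
    let i' : I := ⟨(⟨i - 1, by omega⟩, ⟨i, hiN'⟩), by simp; omega⟩
    have hi' : i'.1.1.succ = i := by ext; simp [i']; omega
    have := hF i' s hs
    simp only [hi'] at this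
    push Not at this
    obtain ⟨t, ht, htC⟩ := this C hC
    obtain ⟨htF, hts⟩ := Finset.mem_filter.1 ht
    refine ⟨t i, htC, ?_⟩
    have : Function.update s i (t i) = t := by
      funext l
      by_cases hl : l = i
      · subst hl; simp
      · have := congrFun hts l
        simp only [Function.update_of_ne hl] at this ⊢
        exact this.symm
    rw [this]
    exact htF

/-! ### Shifting walks inside a replaceable family. -/

/-- The two vertices of a state of a chain. -/
def stateVerts {V : Type*} [DecidableEq V] (p : V × V) : Finset V := {p.1, p.2}

section Shift

variable {V : Type*} [DecidableEq V]

/-- A family of trajectories in which every interior state can be replaced by a state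
avoiding any given set of at most `M` vertices. -/
def IsReplaceable (k M : ℕ) (F : Set (ℕ → V × V)) : Prop :=
  ∀ s ∈ F, ∀ i, 0 < i → i < k + 1 → ∀ S : Finset V, S.card ≤ M →
    ∃ b, Disjoint (stateVerts b) S ∧ Function.update s i b ∈ F

/-- The trajectories in `F` are walks `x₀ z₁ x₁ z₂ x₂ …` of `G`, the states being `(zⱼ, xⱼ)`. -/
def IsWalkFamily (G : SimpleGraph V) (k : ℕ) (F : Set (ℕ → V × V)) : Prop :=
  ∀ s ∈ F, ∀ j ≤ k, G.Adj (s j).2 (s (j + 1)).1 ∧ G.Adj (s (j + 1)).1 (s (j + 1)).2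

variable {k M : ℕ} {F : Set (ℕ → V × V)}

/-- All vertices of the states with index at most `k + 1`. -/
def trajVerts (k : ℕ) (s : ℕ → V × V) : Finset V :=
  (Finset.range (k + 2)).biUnion fun i => stateVerts (s i)

theorem card_trajVerts_le (k : ℕ) (s : ℕ → V × V) : (trajVerts k s).card ≤ 2 * (k + 2) := by
  refine Finset.card_biUnion_le.trans ?_
  refine (Finset.sum_le_card_nsmul _ _ 2 fun i _ => Finset.card_le_two).trans ?_
  simp [mul_comm]

theorem stateVerts_subset_trajVerts {i : ℕ} (s : ℕ → V × V) (hi : i ≤ k + 1) :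
    stateVerts (s i) ⊆ trajVerts k s :=
  Finset.subset_biUnion_of_mem (fun i => stateVerts (s i)) (Finset.mem_range.2 (by omega))

/-- The states of `J` are replaced one at a time, each avoiding `S` and the at most `2 * (k + 2)`
vertices of the current trajectory; later replacements hence stay disjoint from earlier ones. -/
theorem IsReplaceable.exists_replace (hF : IsReplaceable k M F) {S : Finset V}
    (hS : S.card + 2 * (k + 2) ≤ M) {s : ℕ → V × V} (hs : s ∈ F) (J : Finset ℕ)
    (hJ : ∀ j ∈ J, 0 < j ∧ j < k + 1) :
    ∃ s' ∈ F, (∀ i ∉ J, s' i = s i) ∧ ∀ j ∈ J, Disjoint (stateVerts (s' j)) S ∧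
      ∀ i ≤ k + 1, i ≠ j → Disjoint (stateVerts (s' j)) (stateVerts (s' i)) := by
  induction J using Finset.induction_on with
  | empty => exact ⟨s, hs, by simp, by simp⟩
  | insert j₀ J hj₀ ih =>
    obtain ⟨s₁, hs₁, hoff, hon⟩ := ih fun j hj => hJ j (Finset.mem_insert_of_mem hj)
    obtain ⟨h0, hk⟩ := hJ j₀ (Finset.mem_insert_self _ _)
    obtain ⟨b, hb, hbF⟩ := hF s₁ hs₁ j₀ h0 hk (S ∪ trajVerts k s₁)
      ((Finset.card_union_le _ _).trans ((Nat.add_le_add_left (card_trajVerts_le k s₁) _).trans hS))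
    rw [Finset.disjoint_union_right] at hb
    have hne : ∀ i, i ≠ j₀ → Function.update s₁ j₀ b i = s₁ i := fun i hi =>
      Function.update_of_ne hi _ _
    have hfresh : ∀ i ≤ k + 1, Disjoint (stateVerts b) (stateVerts (s₁ i)) := fun i hi =>
      hb.2.mono_right (stateVerts_subset_trajVerts s₁ hi)
    refine ⟨_, hbF, ?_, ?_⟩
    · intro i hi
      rw [Finset.mem_insert, not_or] at hi
      rw [hne i hi.1, hoff i hi.2]
    · intro j hj
      by_cases hjj : j = j₀
      · subst hjj
        rw [Function.update_self]
        refine ⟨hb.1, fun i hi hij => ?_⟩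
        rw [hne i hij]
        exact hfresh i hi
      · have hjJ : j ∈ J := (Finset.mem_insert.1 hj).resolve_left hjj
        rw [hne j hjj]
        refine ⟨(hon j hjJ).1, fun i hi hij => ?_⟩
        by_cases hii : i = j₀
        · subst hii
          rw [Function.update_self]
          exact (hfresh j (by have := (hJ j hj).2; omega)).symm
        · rw [hne i hii]
          exact (hon j hjJ).2 i hi hij

/-- One shift of a whole walk: replace first the states of odd index, then those of even index. -/
theorem IsReplaceable.exists_shift {G : SimpleGraph V} (hF : IsReplaceable k M F)
    (hW : IsWalkFamily G k F) {S : Finset V}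
    (hS : S.card + 2 * (k + 2) ≤ M) {s : ℕ → V × V} (hs : s ∈ F) :
    ∃ s' ∈ F, s' 0 = s 0 ∧ s' k = s k ∧
      (∀ j, 0 < j → j < k → Disjoint (stateVerts (s' j)) S) ∧
      (∀ j, 0 < j → j < k → ∀ i ≤ k, i ≠ j → Disjoint (stateVerts (s' j)) (stateVerts (s' i))) ∧
      ∀ r < k, (Even r → G.Adj (s r).2 (s' (r + 1)).1) ∧
        (Odd r → G.Adj (s' r).2 (s (r + 1)).1) := by
  -- The hybrid `h` has new odd states and old even states. Being itself a walk of the family, it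
  -- provides the adjacencies between `s` and `s'`.
  obtain ⟨h, hh, hoff, hon⟩ := hF.exists_replace hS hs ((Finset.Ioo 0 k).filter Odd)
    (by intro j hj; simp only [Finset.mem_filter, Finset.mem_Ioo] at hj; omega)
  obtain ⟨s', hs', hoff', hon'⟩ := hF.exists_replace hS hh ((Finset.Ioo 0 k).filter Even)
    (by intro j hj; simp only [Finset.mem_filter, Finset.mem_Ioo] at hj; omega)
  simp only [Finset.mem_filter, Finset.mem_Ioo] at hoff hon hoff' hon'
  have hodd : ∀ j, Odd j → s' j = h j := fun j hj =>
    hoff' j fun h => (Nat.not_even_iff_odd.2 hj) h.2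
  have heven : ∀ j, Even j → h j = s j := fun j hj =>
    hoff j fun h => (Nat.not_odd_iff_even.2 hj) h.2
  have hkk : h k = s k := hoff k (by omega)
  refine ⟨s', hs', ?_, ?_, ?_, ?_, ?_⟩
  · rw [hoff' 0 (by omega), hoff 0 (by omega)]
  · rw [hoff' k (by omega), hkk]
  · intro j h0 hjk
    rcases Nat.even_or_odd j with hj | hj
    · exact (hon' j ⟨⟨h0, hjk⟩, hj⟩).1
    · rw [hodd j hj]
      exact (hon j ⟨⟨h0, hjk⟩, hj⟩).1
  · intro j h0 hjk i hi hij
    rcases Nat.even_or_odd j with hj | hj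
    · exact (hon' j ⟨⟨h0, hjk⟩, hj⟩).2 i (by omega) hij
    · by_cases hi' : (0 < i ∧ i < k) ∧ Even i
      · exact ((hon' i hi').2 j (by omega) hij.symm).symm
      · rw [hodd j hj, hoff' i hi']
        exact (hon j ⟨⟨h0, hjk⟩, hj⟩).2 i (by omega) hij
  · intro r hr
    have := (hW h hh r (by omega)).1
    refine ⟨fun he => ?_, fun ho => ?_⟩
    · rw [heven r he] at this
      rwa [hodd (r + 1) he.add_one]
    · rw [heven (r + 1) ho.add_one] at this
      rwa [hodd r ho]

/-- Successive shifts of a walk, all using new vertices. -/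
theorem IsReplaceable.exists_shifts {G : SimpleGraph V} (hF : IsReplaceable k M F)
    (hW : IsWalkFamily G k F) {s : ℕ → V × V} (hs : s ∈ F) (T : ℕ)
    (hT : (T + 2) * (2 * (k + 2)) ≤ M) :
    ∃ q : ℕ → ℕ → V × V, (∀ m ≤ T, q m ∈ F ∧ q m 0 = s 0 ∧ q m k = s k) ∧
      (∀ m ≤ T, 0 < m → ∀ j, 0 < j → j < k → ∀ i ≤ k,
        (i ≠ j → Disjoint (stateVerts (q m j)) (stateVerts (q m i))) ∧
        ∀ m' < m, Disjoint (stateVerts (q m j)) (stateVerts (q m' i))) ∧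
      ∀ m < T, ∀ r < k, (Even r → G.Adj (q m r).2 (q (m + 1) (r + 1)).1) ∧
        (Odd r → G.Adj (q (m + 1) r).2 (q m (r + 1)).1) := by
  induction T with
  | zero =>
    refine ⟨fun _ => s, fun m _ => ⟨hs, rfl, rfl⟩, fun m hm hm0 => by omega, fun m hm => by omega⟩
  | succ T ih =>
    obtain ⟨q, hqF, hqd, hqa⟩ := ih (le_trans (Nat.mul_le_mul_right _ (by omega)) hT)
    set S := (Finset.range (T + 1)).biUnion fun m => trajVerts k (q m) with hSdef
    have hS : S.card + 2 * (k + 2) ≤ M := by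
      refine le_trans (Nat.add_le_add_right (Finset.card_biUnion_le.trans
        (Finset.sum_le_card_nsmul _ _ (2 * (k + 2)) fun m _ => card_trajVerts_le k (q m))) _) ?_
      refine le_trans (le_of_eq ?_) (le_trans (Nat.mul_le_mul_right _ (Nat.le_succ (T + 2))) hT)
      simp; ring
    obtain ⟨s', hs'F, h0, hk', hdS, hd, ha⟩ := hF.exists_shift hW hS (hqF T le_rfl).1
    have hnew : Function.update q (T + 1) s' (T + 1) = s' := Function.update_self _ _ _
    have hold : ∀ m ≤ T, Function.update q (T + 1) s' m = q m := fun m hm =>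
      Function.update_of_ne (by omega) _ _
    refine ⟨Function.update q (T + 1) s', ?_, ?_, ?_⟩
    · intro m hm
      rcases Nat.lt_or_ge T m with h | h
      · obtain rfl : m = T + 1 := by omega
        rw [hnew, h0, hk']
        exact ⟨hs'F, (hqF T le_rfl).2⟩
      · rw [hold m h]
        exact hqF m h
    · intro m hm hm0 j hj0 hjk i hi
      rcases Nat.lt_or_ge T m with h | h
      · obtain rfl : m = T + 1 := by omega
        rw [hnew]
        refine ⟨hd j hj0 hjk i hi, fun m' hm' => ?_⟩
        rw [hold m' (by omega)]
        refine (hdS j hj0 hjk).mono_right ((stateVerts_subset_trajVerts (k := k) (q m') (by omega)).trans ?_)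
        exact Finset.subset_biUnion_of_mem (fun m => trajVerts k (q m)) (Finset.mem_range.2 hm')
      · rw [hold m h]
        refine ⟨(hqd m h hm0 j hj0 hjk i hi).1, fun m' hm' => ?_⟩
        rw [hold m' (by omega)]
        exact (hqd m h hm0 j hj0 hjk i hi).2 m' hm'
    · intro m hm r hr
      rcases Nat.lt_or_ge m T with h | h
      · rw [hold m (by omega), hold (m + 1) (by omega)]
        exact hqa m h r hr
      · obtain rfl : m = T := by omega
        rw [hold m le_rfl, hnew]
        exact ha r hr

end Shift

/-! ### Assembling the honeycomb from successive shifts. -/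

/-- The vertex of the `⌈j/2⌉`-th walk that plays the role of the label `x_{i,j}`. -/
def honeycombPlace {V : Type*} (q : ℕ → ℕ → V × V) (i j : ℕ) : V :=
  if Even (i + j) then (q ((j + 1) / 2) i).1 else (q ((j + 1) / 2) (i - 1)).2

/-- Walk `m` carries columns `2m - 1` and `2m`; edges inside these columns and between them are walk
edges, while edges from column `2m` to column `2m + 1` come from `hcross`. Walk `0` carries no
column and may repeat vertices: only its ends matter. -/
theorem honeycombGraph_isContained_of_shifts {V : Type*} [DecidableEq V] {G : SimpleGraph V}
    {k ℓ : ℕ} (hk : Odd k) (q : ℕ → ℕ → V × V)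
    (hend : ∀ m ≤ ℓ, q m 0 = q 0 0 ∧ q m k = q 0 k) (huv : (q 0 k).1 ≠ (q 0 0).2)
    (hwalk : ∀ m ≤ ℓ, ∀ j < k,
      G.Adj (q m j).2 (q m (j + 1)).1 ∧ G.Adj (q m (j + 1)).1 (q m (j + 1)).2)
    (hdisj : ∀ m ≤ ℓ, 0 < m → ∀ j, 0 < j → j < k → ∀ i ≤ k,
        (i ≠ j → Disjoint (stateVerts (q m j)) (stateVerts (q m i))) ∧
        ∀ m' < m, Disjoint (stateVerts (q m j)) (stateVerts (q m' i)))
    (hcross : ∀ m < ℓ, ∀ r < k, (Even r → G.Adj (q m r).2 (q (m + 1) (r + 1)).1) ∧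
        (Odd r → G.Adj (q (m + 1) r).2 (q m (r + 1)).1)) :
    (honeycombGraph k ℓ).IsContained G := by
  let f : HoneycombIndex k ℓ → V := fun p => honeycombPlace q p.1.1 p.1.2
  have hu : ∀ j ≤ ℓ, Odd j → honeycombPlace q k j = (q 0 k).1 := by
    intro j hj ho
    rw [honeycombPlace, if_pos (hk.add_odd ho), (hend _ (by omega)).2]
  have hv : ∀ j ≤ ℓ, Even j → honeycombPlace q 1 j = (q 0 0).2 := by
    intro j hj ho
    rw [honeycombPlace, if_neg (by rw [Nat.not_even_iff_odd]; exact odd_one.add_even ho),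
      Nat.sub_self, (hend _ (by omega)).1]
  have hf : ∀ p p' : HoneycombIndex k ℓ, (honeycombSetoid k ℓ) p p' → f p = f p' := by
    rintro ⟨⟨i, j⟩, hp⟩ ⟨⟨i', j'⟩, hp'⟩ h
    have hp1 := hp
    have hp1' := hp'
    simp only [Finset.mem_product, Finset.mem_Icc] at hp1 hp1'
    rcases h with h | ⟨h1, h2, h3, h4⟩ | ⟨h1, h2, h3, h4⟩
    · rw [h]
    · simp only at h1 h2 h3 h4
      simp only [f]
      rw [h1, h3, hu j (by omega) h2, hu j' (by omega) h4]
    · simp only at h1 h2 h3 h4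
      simp only [f]
      rw [h1, h3, hv j (by omega) h2, hv j' (by omega) h4]
  -- Every label other than those of `u` and `v` lies in a state `r` with `0 < r < k`, where the
  -- disjointness hypotheses apply.
  have hint : ∀ i j, 1 ≤ i → i ≤ k → ¬ (i = k ∧ Odd j) → ¬ (i = 1 ∧ Even j) →
      ∃ r, 0 < r ∧ r < k ∧ (Even (i + j) ∧ r = i ∧ honeycombPlace q i j = (q ((j + 1) / 2) r).1 ∨
        Odd (i + j) ∧ r + 1 = i ∧ honeycombPlace q i j = (q ((j + 1) / 2) r).2) := by
    intro i j hi1 hik h1 h2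
    rcases Nat.even_or_odd (i + j) with h | h
    · refine ⟨i, by omega, ?_, Or.inl ⟨h, rfl, if_pos h⟩⟩
      refine lt_of_le_of_ne hik fun hi => h1 ⟨hi, ?_⟩
      subst hi
      rcases Nat.even_or_odd j with hj | hj
      · exact absurd h (Nat.not_even_iff_odd.2 (hk.add_even hj))
      · exact hj
    · refine ⟨i - 1, ?_, by omega,
        Or.inr ⟨h, by omega, if_neg (Nat.not_even_iff_odd.2 h)⟩⟩
      by_contra h0
      obtain rfl : i = 1 := by omega
      refine h2 ⟨rfl, ?_⟩
      rcases Nat.even_or_odd j with hj | hj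
      · exact hj
      · exact absurd h (Nat.not_odd_iff_even.2 (odd_one.add_odd hj))
  have hsep : ∀ m ≤ ℓ, 0 < m → ∀ r, 0 < r → r < k → ∀ m' ≤ m, ∀ i ≤ k, ∀ x,
      x ∈ stateVerts (q m r) → x ∈ stateVerts (q m' i) → m' = m ∧ i = r := by
    intro m hm hm0 r hr0 hrk m' hm' i hi x hx hx'
    obtain ⟨h1, h2⟩ := hdisj m hm hm0 r hr0 hrk i hi
    have hmm : m' = m := by
      by_contra hne
      exact Finset.disjoint_left.1 (h2 m' (by omega)) hx hx'
    subst hmm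
    refine ⟨rfl, ?_⟩
    by_contra hne
    exact Finset.disjoint_left.1 (h1 hne) hx hx'
  have hmem1 : ∀ p : V × V, p.1 ∈ stateVerts p := fun p => by simp [stateVerts]
  have hmem2 : ∀ p : V × V, p.2 ∈ stateVerts p := fun p => by simp [stateVerts]
  have hinj_int : ∀ i j i' j', 1 ≤ i → i ≤ k → 1 ≤ j → j ≤ ℓ → 1 ≤ i' → i' ≤ k → 1 ≤ j' →
      j' ≤ j → ¬ (i = k ∧ Odd j) → ¬ (i = 1 ∧ Even j) → ¬ (i' = k ∧ Odd j') →
      ¬ (i' = 1 ∧ Even j') → honeycombPlace q i j = honeycombPlace q i' j' → i = i' ∧ j = j' := by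
    intro i j i' j' hi1 hik hj1 hjl hi1' hik' hj1' hjj h1 h2 h1' h2' heq
    obtain ⟨r, hr0, hrk, hr⟩ := hint i j hi1 hik h1 h2
    obtain ⟨r', hr0', hrk', hr'⟩ := hint i' j' hi1' hik' h1' h2'
    have hx : honeycombPlace q i j ∈ stateVerts (q ((j + 1) / 2) r) := by
      rcases hr with hr | hr <;> rw [hr.2.2]
      exacts [hmem1 _, hmem2 _]
    have hx' : honeycombPlace q i' j' ∈ stateVerts (q ((j' + 1) / 2) r') := by
      rcases hr' with hr' | hr' <;> rw [hr'.2.2]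
      exacts [hmem1 _, hmem2 _]
    rw [← heq] at hx'
    obtain ⟨e1, e2⟩ := hsep _ (by omega) (by omega) r hr0 hrk _ (by omega) r' (by omega) _ hx hx'
    have hne : (q ((j + 1) / 2) r).1 ≠ (q ((j + 1) / 2) r).2 := by
      have := (hwalk ((j + 1) / 2) (by omega) (r - 1) (by omega)).2.ne
      rwa [Nat.sub_add_cancel hr0] at this
    rw [e1, e2] at hr'
    rcases hr with ⟨ha, hb, hc⟩ | ⟨ha, hb, hc⟩ <;> rcases hr' with ⟨ha', hb', hc'⟩ | ⟨ha', hb', hc'⟩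
    · grind
    · exact absurd (hc.symm.trans (heq.trans hc')) hne
    · exact absurd (hc'.symm.trans (heq.symm.trans hc)) hne
    · grind
  have hne_end : ∀ i j, 1 ≤ i → i ≤ k → 1 ≤ j → j ≤ ℓ → ¬ (i = k ∧ Odd j) → ¬ (i = 1 ∧ Even j) →
      honeycombPlace q i j ≠ (q 0 k).1 ∧ honeycombPlace q i j ≠ (q 0 0).2 := by
    intro i j hi1 hik hj1 hjl h1 h2
    obtain ⟨r, hr0, hrk, hr⟩ := hint i j hi1 hik h1 h2
    have hx : honeycombPlace q i j ∈ stateVerts (q ((j + 1) / 2) r) := by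
      rcases hr with hr | hr <;> rw [hr.2.2]
      exacts [hmem1 _, hmem2 _]
    refine ⟨fun h => ?_, fun h => ?_⟩
    · have := hsep _ (by omega) (by omega) r hr0 hrk 0 (by omega) k le_rfl _ hx (h ▸ hmem1 _)
      omega
    · have := hsep _ (by omega) (by omega) r hr0 hrk 0 (by omega) 0 (by omega) _ hx (h ▸ hmem2 _)
      omega
  have hinj : ∀ p p' : HoneycombIndex k ℓ, f p = f p' → (honeycombSetoid k ℓ) p p' := by
    rintro ⟨⟨i, j⟩, hp⟩ ⟨⟨i', j'⟩, hp'⟩ h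
    have hp1 := hp
    have hp1' := hp'
    simp only [Finset.mem_product, Finset.mem_Icc] at hp1 hp1'
    obtain ⟨⟨hi1, hik⟩, hj1, hjl⟩ := hp1
    obtain ⟨⟨hi1', hik'⟩, hj1', hjl'⟩ := hp1'
    change honeycombPlace q i j = honeycombPlace q i' j' at h
    change _ ∨ (i = k ∧ Odd j ∧ i' = k ∧ Odd j') ∨ (i = 1 ∧ Even j ∧ i' = 1 ∧ Even j')
    by_cases h1 : i = k ∧ Odd j
    · obtain ⟨rfl, ho⟩ := h1
      rw [hu j hjl ho] at h
      by_cases h1' : i' = i ∧ Odd j'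
      · exact Or.inr (Or.inl ⟨rfl, ho, h1'⟩)
      · by_cases h2' : i' = 1 ∧ Even j'
        · rw [h2'.1, hv j' hjl' h2'.2] at h
          exact absurd h huv
        · exact absurd h.symm (hne_end i' j' hi1' hik' hj1' hjl' h1' h2').1
    by_cases h2 : i = 1 ∧ Even j
    · rw [h2.1, hv j hjl h2.2] at h
      by_cases h1' : i' = k ∧ Odd j'
      · rw [h1'.1, hu j' hjl' h1'.2] at h
        exact absurd h.symm huv
      · by_cases h2' : i' = 1 ∧ Even j'
        · exact Or.inr (Or.inr ⟨h2.1, h2.2, h2'⟩)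
        · exact absurd h.symm (hne_end i' j' hi1' hik' hj1' hjl' h1' h2').2
    by_cases h1' : i' = k ∧ Odd j'
    · rw [h1'.1, hu j' hjl' h1'.2] at h
      exact absurd h (hne_end i j hi1 hik hj1 hjl h1 h2).1
    by_cases h2' : i' = 1 ∧ Even j'
    · rw [h2'.1, hv j' hjl' h2'.2] at h
      exact absurd h (hne_end i j hi1 hik hj1 hjl h1 h2).2
    left
    have : i = i' ∧ j = j' := by
      rcases le_total j' j with hjj | hjj
      · exact hinj_int i j i' j' hi1 hik hj1 hjl hi1' hik' hj1' hjj h1 h2 h1' h2' h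
      · have := hinj_int i' j' i j hi1' hik' hj1' hjl' hi1 hik hj1 hjj h1' h2' h1 h2 h.symm
        exact ⟨this.1.symm, this.2.symm⟩
    obtain ⟨rfl, rfl⟩ := this
    rfl
  have hadj : ∀ p p' : HoneycombIndex k ℓ, honeycombEdge k ℓ p p' → G.Adj (f p) (f p') := by
    rintro ⟨⟨i, j⟩, hp⟩ ⟨⟨i', j'⟩, hp'⟩ h
    have hp1 := hp
    have hp1' := hp'
    simp only [Finset.mem_product, Finset.mem_Icc] at hp1 hp1'
    obtain ⟨⟨hi1, hik⟩, hj1, hjl⟩ := hp1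
    obtain ⟨⟨hi1', hik'⟩, hj1', hjl'⟩ := hp1'
    change (i' = i ∧ j' = j + 1) ∨ (i' = i + 1 ∧ j' = j ∧ Odd i ∧ Odd j) ∨
      (i' = i + 1 ∧ j' = j ∧ Even i ∧ Even j) at h
    change G.Adj (honeycombPlace q i j) (honeycombPlace q i' j')
    obtain ⟨r, rfl⟩ : ∃ r, i = r + 1 := ⟨i - 1, by omega⟩
    rcases h with ⟨rfl, rfl⟩ | ⟨rfl, rfl, hi, hj⟩ | ⟨rfl, rfl, hi, hj⟩
    · rcases Nat.even_or_odd j with hj | hj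
      · have e : (j + 1 + 1) / 2 = (j + 1) / 2 + 1 := by grind
        have hc := hcross ((j + 1) / 2) (by grind) r (by omega)
        rcases Nat.even_or_odd r with hr | hr
        · rw [honeycombPlace, honeycombPlace, if_neg (by grind), if_pos (by grind), e]
          exact hc.1 hr
        · rw [honeycombPlace, honeycombPlace, if_pos (by grind), if_neg (by grind), e]
          exact (hc.2 hr).symm
      · have e : (j + 1 + 1) / 2 = (j + 1) / 2 := by grind
        have hw := (hwalk ((j + 1) / 2) (by omega) r (by omega)).1
        rcases Nat.even_or_odd r with hr | hr
        · rw [honeycombPlace, honeycombPlace, if_pos (by grind), if_neg (by grind), e]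
          exact hw.symm
        · rw [honeycombPlace, honeycombPlace, if_neg (by grind), if_pos (by grind), e]
          exact hw
    all_goals
      have hw := (hwalk ((j' + 1) / 2) (by omega) r (by omega)).2
      rw [honeycombPlace, honeycombPlace, if_pos (by grind), if_neg (by grind)]
      exact hw
  let φ : HoneycombVertex k ℓ → V := Quotient.lift f hf
  refine ⟨⟨⟨φ, ?_⟩, ?_⟩⟩
  · intro a b hab
    rw [honeycombGraph, SimpleGraph.fromRel_adj] at hab
    rcases hab.2 with ⟨p, p', h, rfl, rfl⟩ | ⟨p, p', h, rfl, rfl⟩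
    · exact hadj p p' h
    · exact (hadj p p' h).symm
  · intro a b
    induction a using Quotient.inductionOn with | _ p => ?_
    induction b using Quotient.inductionOn with | _ p' => ?_
    intro h
    exact Quotient.sound (hinj p p' h)

/-- A nonempty replaceable family of walks yields the honeycomb graph. -/
theorem honeycombGraph_isContained_of_isReplaceable {V : Type*} [DecidableEq V]
    {G : SimpleGraph V} {k ℓ M : ℕ} {F : Set (ℕ → V × V)} (hk : Odd k)
    (hM : (ℓ + 2) * (2 * (k + 2)) ≤ M) (hF : IsReplaceable k M F) (hW : IsWalkFamily G k F)
    (hne : F.Nonempty) : (honeycombGraph k ℓ).IsContained G := by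
  obtain ⟨s, hs⟩ := hne
  have hk0 : 0 < k := hk.pos
  -- State `k` is itself interior because trajectories run on to `k + 1`; one replacement ensures `u
  -- ≠ v`.
  obtain ⟨b, hb, hbF⟩ := hF s hs k hk0 (by omega) {(s 0).2}
    (by rw [Finset.card_singleton]; exact le_trans (by nlinarith) hM)
  obtain ⟨q, hqF, hqd, hqa⟩ := hF.exists_shifts hW hbF ℓ hM
  refine honeycombGraph_isContained_of_shifts hk q ?_ ?_ ?_ hqd hqa
  · intro m hm
    rw [(hqF m hm).2.1, (hqF m hm).2.2, (hqF 0 (by omega)).2.1, (hqF 0 (by omega)).2.2]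
    exact ⟨rfl, rfl⟩
  · rw [(hqF 0 (by omega)).2.1, (hqF 0 (by omega)).2.2, Function.update_self,
      Function.update_of_ne hk0.ne]
    simp only [Finset.disjoint_singleton_right, stateVerts, Finset.mem_insert,
      Finset.mem_singleton, not_or] at hb
    exact Ne.symm hb.1
  · intro m hm j hj
    exact hW _ (hqF m hm).1 j hj.le

/-! ### From a Markov chain on states to the honeycomb. -/

/-- A stationary chain of states `(z, x)` in which no vertex carries much of the ways to fill a hole
yields the honeycomb graph. -/
theorem honeycombGraph_isContained_of_chain {V : Type*} [Fintype V] [DecidableEq V]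
    {G : SimpleGraph V} {k ℓ M : ℕ} (hk : Odd k) (hM : (ℓ + 2) * (2 * (k + 2)) ≤ M)
    (p : V × V → ℝ) (K β : V × V → V × V → ℝ) (good : V × V → V × V → Prop) {ε c : ℝ}
    (hKG : ∀ a b, 0 < K a b → G.Adj a.2 b.1 ∧ G.Adj b.1 b.2)
    (hp0 : ∀ x, 0 ≤ p x) (hK0 : ∀ x y, 0 ≤ K x y) (hβ0 : ∀ x y, 0 ≤ β x y)
    (hrow : ∀ x, ∑ y, K x y ≤ 1) (hstat : ∀ y, ∑ x, p x * K x y = p y)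
    (hbad : ∀ [DecidableRel good], ∑ a, ∑ b, p a * (if good a b then 0 else K a b) ≤ ε * ∑ a, p a)
    (hfst : ∀ u a d, ∀ B : Finset V, (∀ x ∈ B, good a (u, x) ∧ good (u, x) d) →
      ∑ x ∈ B, K a (u, x) * K (u, x) d ≤ β a d)
    (hsnd : ∀ u a d, ∀ B : Finset V, (∀ x ∈ B, good a (x, u) ∧ good (x, u) d) →
      ∑ x ∈ B, K a (x, u) * K (x, u) d ≤ β a d)
    (hβ : ∑ a, ∑ d, p a * β a d ≤ c * ∑ a, p a)
    (hpos : 0 < ∑ a, p a) (hlt : (k + 2) * (ε + 2 * M * c) < 1) (hε : 0 ≤ ε) (hc : 0 ≤ c) :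
    (honeycombGraph k ℓ).IsContained G := by
  classical
  -- A state meeting `S` has its first or its second entry in `S`: at most `2 * M` classes with one
  -- entry fixed, each charged `β`.
  let 𝒞 : Set (Set (V × V)) := {C | ∃ S : Finset V, S.card ≤ M ∧ C = {b | b.1 ∈ S ∨ b.2 ∈ S}}
  obtain ⟨F, hFne, hFK, hFrep⟩ : ∃ F : Set (Fin (k + 1 + 1) → V × V), F.Nonempty ∧
      (∀ s ∈ F, ∀ j : Fin (k + 1), 0 < K (s j.castSucc) (s j.succ)) ∧
      ∀ s ∈ F, ∀ i : Fin (k + 1 + 1), 0 < i → i < Fin.last (k + 1) → ∀ C ∈ 𝒞,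
        ∃ b ∉ C, Function.update s i b ∈ F := by
    refine exists_robust_chain (k + 1) p K (fun a d => 2 * M * β a d) good 𝒞
      (ε := ε) (c := 2 * M * c) hp0 hK0 (fun x y => mul_nonneg (by positivity) (hβ0 x y)) hrow hstat
      hbad ?_ ?_ hpos (by push_cast; linarith) hε (by positivity)
    · rintro C ⟨S, hS, rfl⟩ a d B hB
      let g : V × V → ℝ := fun b => K a b * K b d
      have hg0 : ∀ b, 0 ≤ g b := fun b => mul_nonneg (hK0 _ _) (hK0 _ _)
      have h1 : ∀ u, ∑ b ∈ B with b.1 = u, g b ≤ β a d := by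
        intro u
        have e : ∑ b ∈ B with b.1 = u, g b
            = ∑ x ∈ (B.filter fun b => b.1 = u).image Prod.snd, g (u, x) := by
          rw [Finset.sum_image]
          · refine Finset.sum_congr rfl fun b hb => ?_
            rw [← (Finset.mem_filter.1 hb).2]
          · intro b hb b' hb' h
            exact Prod.ext ((Finset.mem_filter.1 hb).2.trans (Finset.mem_filter.1 hb').2.symm) h
        rw [e]
        refine hfst u a d _ fun x hx => ?_
        obtain ⟨b, hb, rfl⟩ := Finset.mem_image.1 hx
        obtain rfl := (Finset.mem_filter.1 hb).2
        exact (hB b (Finset.mem_filter.1 hb).1).2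
      have h2 : ∀ u, ∑ b ∈ B with b.2 = u, g b ≤ β a d := by
        intro u
        have e : ∑ b ∈ B with b.2 = u, g b
            = ∑ x ∈ (B.filter fun b => b.2 = u).image Prod.fst, g (x, u) := by
          rw [Finset.sum_image]
          · refine Finset.sum_congr rfl fun b hb => ?_
            rw [← (Finset.mem_filter.1 hb).2]
          · intro b hb b' hb' h
            exact Prod.ext h ((Finset.mem_filter.1 hb).2.trans (Finset.mem_filter.1 hb').2.symm)
        rw [e]
        refine hsnd u a d _ fun x hx => ?_
        obtain ⟨b, hb, rfl⟩ := Finset.mem_image.1 hx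
        obtain rfl := (Finset.mem_filter.1 hb).2
        exact (hB b (Finset.mem_filter.1 hb).1).2
      have h3 : ∑ b ∈ B, g b
          ≤ ∑ u ∈ S, (∑ b ∈ B with b.1 = u, g b + ∑ b ∈ B with b.2 = u, g b) := by
        simp only [Finset.sum_filter, ← Finset.sum_add_distrib]
        rw [Finset.sum_comm]
        refine Finset.sum_le_sum fun b hb => ?_
        have hnn : ∀ u ∈ S, 0 ≤ (if b.1 = u then g b else 0) + (if b.2 = u then g b else 0) := by
          intro u _
          have := hg0 b
          split_ifs <;> linarith
        have := hg0 b
        rcases (hB b hb).1 with h | h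
        · refine le_trans ?_ (Finset.single_le_sum hnn h)
          rw [if_pos rfl]
          split_ifs <;> linarith
        · refine le_trans ?_ (Finset.single_le_sum hnn h)
          rw [if_pos rfl]
          split_ifs <;> linarith
      refine h3.trans ((Finset.sum_le_sum fun u _ => add_le_add (h1 u) (h2 u)).trans ?_)
      rw [Finset.sum_const, nsmul_eq_mul]
      have : (S.card : ℝ) ≤ M := by exact_mod_cast hS
      nlinarith [hβ0 a d]
    · have : ∑ a, ∑ d, p a * (2 * M * β a d) = 2 * M * ∑ a, ∑ d, p a * β a d := by
        simp only [Finset.mul_sum]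
        refine Finset.sum_congr rfl fun a _ => Finset.sum_congr rfl fun d _ => by ring
      rw [this, mul_assoc]
      simp only [mul_assoc]
      have := mul_le_mul_of_nonneg_left hβ (show (0 : ℝ) ≤ 2 * M by positivity)
      linarith
  let F' : Set (ℕ → V × V) := {s | (fun i : Fin (k + 2) => s i) ∈ F}
  refine honeycombGraph_isContained_of_isReplaceable (F := F') hk hM ?_ ?_ ?_
  · intro s hs i hi0 hik S hS
    obtain ⟨b, hb, hbF⟩ := hFrep _ hs ⟨i, by omega⟩ (by simpa [Fin.lt_def] using hi0)
      (by simpa [Fin.lt_def] using hik) _ ⟨S, hS, rfl⟩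
    refine ⟨b, ?_, ?_⟩
    · simp only [Set.mem_ofPred_eq, not_or] at hb
      rw [stateVerts, Finset.disjoint_insert_left, Finset.disjoint_singleton_left]
      exact hb
    · change (fun j : Fin (k + 2) => Function.update s i b j) ∈ F
      convert hbF using 1
      funext j
      simp [Function.update_apply, Fin.ext_iff]
  · intro s hs j hj
    have := hKG _ _ (hFK _ hs ⟨j, by omega⟩)
    simpa using this
  · obtain ⟨s, hs⟩ := hFne
    refine ⟨fun n => if h : n < k + 2 then s ⟨n, h⟩ else s 0, ?_⟩
    change (fun i : Fin (k + 2) => if h : (i : ℕ) < k + 2 then s ⟨i, h⟩ else s 0) ∈ F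
    simpa using hs

/-! ### The light case: simple random walk. -/

section Weights

variable {V : Type*}

open Classical in
/-- The adjacency indicator. -/
noncomputable def adjW (G : SimpleGraph V) (x y : V) : ℝ := if G.Adj x y then 1 else 0

section

variable (G : SimpleGraph V)

theorem adjW_nonneg (x y : V) : 0 ≤ adjW G x y := by
  rw [adjW]; split_ifs <;> norm_num

theorem adjW_le_one (x y : V) : adjW G x y ≤ 1 := by
  rw [adjW]; split_ifs <;> norm_num

theorem adjW_comm (x y : V) : adjW G x y = adjW G y x := by
  by_cases h : G.Adj x y
  · rw [adjW, adjW, if_pos h, if_pos h.symm]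
  · rw [adjW, adjW, if_neg h, if_neg fun h' => h h'.symm]

theorem adjW_pos {x y : V} : 0 < adjW G x y ↔ G.Adj x y := by
  rw [adjW]; split_ifs with h <;> simp [h]

end

variable [Fintype V]

/-- The degree, as a real number. -/
noncomputable def degW (G : SimpleGraph V) (x : V) : ℝ := ∑ y, adjW G x y

/-- The codegree, as a real number. -/
noncomputable def codegW (G : SimpleGraph V) (x y : V) : ℝ := ∑ u, adjW G x u * adjW G u y

/-- A pair of vertices is heavy if its codegree is large compared to the degrees. -/
def IsHeavyPair (G : SimpleGraph V) (L δ : ℝ) (x y : V) : Prop :=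
  L / δ * max (degW G x) (degW G y) < codegW G x y

open Classical in
/-- The indicator of the heavy pairs. -/
noncomputable def heavyW (G : SimpleGraph V) (L δ : ℝ) (x y : V) : ℝ :=
  if IsHeavyPair G L δ x y then 1 else 0

variable (G : SimpleGraph V) {L δ : ℝ}

theorem codegW_nonneg (x y : V) : 0 ≤ codegW G x y :=
  Finset.sum_nonneg fun _ _ => mul_nonneg (adjW_nonneg G _ _) (adjW_nonneg G _ _)

theorem codegW_comm (x y : V) : codegW G x y = codegW G y x :=
  Finset.sum_congr rfl fun u _ => by rw [adjW_comm G x u, adjW_comm G u y, mul_comm]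

theorem heavyW_nonneg (x y : V) : 0 ≤ heavyW G L δ x y := by
  rw [heavyW]; split_ifs <;> norm_num

/-- The form used for the random walk: `codegW G x y / (degW G x * degW G y)` is what remains when a
vertex between `x` and `y` is summed out. -/
theorem codegW_div_le_of_not_isHeavyPair (hδ : 0 < δ) (hL : 0 ≤ L) {x y : V}
    (hx : δ ≤ degW G x) (hy : δ ≤ degW G y) (h : ¬ IsHeavyPair G L δ x y) :
    codegW G x y / (degW G x * degW G y) ≤ L / δ ^ 2 := by
  rw [IsHeavyPair, not_lt] at h
  have hx0 : 0 < degW G x := hδ.trans_le hx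
  have hy0 : 0 < degW G y := hδ.trans_le hy
  rw [div_le_iff₀ (by positivity)]
  refine h.trans ?_
  have : max (degW G x) (degW G y) ≤ degW G x * degW G y / δ := by
    rw [le_div_iff₀ hδ]
    rcases max_cases (degW G x) (degW G y) with ⟨h, -⟩ | ⟨h, -⟩ <;> rw [h]
    · exact mul_le_mul_of_nonneg_left hy hx0.le
    · rw [mul_comm]
      exact mul_le_mul_of_nonneg_right hx hy0.le
  calc L / δ * max (degW G x) (degW G y) ≤ L / δ * (degW G x * degW G y / δ) :=
        mul_le_mul_of_nonneg_left this (by positivity)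
    _ = L / δ ^ 2 * (degW G x * degW G y) := by field_simp

/-- Honeycombs in graphs in which few cherries have heavy ends: walk at random along
cherries with light ends. -/
theorem honeycombGraph_isContained_of_light [DecidableEq V] {k ℓ M : ℕ} (hk : Odd k)
    (hM : (ℓ + 2) * (2 * (k + 2)) ≤ M) [Nonempty V] (hδ : 0 < δ) (hdeg : ∀ x, δ ≤ degW G x)
    (hL : 0 ≤ L) {ε : ℝ} (hε : 0 ≤ ε)
    (hlight : ∀ a, ∑ x, ∑ y, adjW G a x * adjW G a y * heavyW G L δ x y ≤ ε * degW G a ^ 2)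
    (hlt : (k + 2) * (2 * ε + 2 * M * (2 * Fintype.card V * L / δ ^ 3)) < 1) :
    (honeycombGraph k ℓ).IsContained G := by
  classical
  have hd0 : ∀ x, 0 < degW G x := fun x => hδ.trans_le (hdeg x)
  have hdne : ∀ x, degW G x ≠ 0 := fun x => (hd0 x).ne'
  -- Two steps of simple random walk at a time, started uniformly on directed edges. A transition
  -- `(z, x) → (z', x')` is good when the ends of both cherries `z x z'` and `x z' x'` are light.
  let p : V × V → ℝ := fun a => adjW G a.1 a.2
  let K : V × V → V × V → ℝ := fun a b =>
    adjW G a.2 b.1 * adjW G b.1 b.2 / (degW G a.2 * degW G b.1)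
  let β : V × V → V × V → ℝ := fun a b =>
    adjW G b.1 b.2 * (L / δ ^ 3 * (1 / degW G a.2 + 1 / degW G b.1))
  let good : V × V → V × V → Prop := fun a b =>
    ¬ IsHeavyPair G L δ a.1 b.1 ∧ ¬ IsHeavyPair G L δ a.2 b.2
  have hA0 := adjW_nonneg G
  have hK0 : ∀ a b, 0 ≤ K a b := fun a b => by
    have := hd0 a.2; have := hd0 b.1; have := hA0 a.2 b.1; have := hA0 b.1 b.2
    positivity
  have hβ0 : ∀ a b, 0 ≤ β a b := fun a b => by
    have := hd0 a.2; have := hd0 b.1; have := hA0 b.1 b.2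
    positivity
  have hptot : ∑ a, p a = ∑ x, degW G x := by
    simp only [p, Fintype.sum_prod_type, degW]
  refine honeycombGraph_isContained_of_chain hk hM p K β good (ε := 2 * ε)
    (c := 2 * Fintype.card V * L / δ ^ 3) ?_ (fun a => hA0 _ _) hK0 hβ0 ?_ ?_ ?_ ?_ ?_ ?_ ?_ hlt
    (by positivity) (by positivity)
  · intro a b hab
    have h1 : 0 < adjW G a.2 b.1 := by
      refine lt_of_le_of_ne (hA0 _ _) fun h => ?_
      simp only [K, ← h, zero_mul, zero_div, lt_irrefl] at hab
    have h2 : 0 < adjW G b.1 b.2 := by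
      refine lt_of_le_of_ne (hA0 _ _) fun h => ?_
      simp only [K, ← h, mul_zero, zero_div, lt_irrefl] at hab
    exact ⟨(adjW_pos G).1 h1, (adjW_pos G).1 h2⟩
  · rintro ⟨z, x⟩
    refine le_of_eq ?_
    simp only [K, Fintype.sum_prod_type]
    have : ∀ z', ∑ x', adjW G x z' * adjW G z' x' / (degW G x * degW G z')
        = adjW G x z' / degW G x := by
      intro z'
      rw [← Finset.sum_div, ← Finset.mul_sum, ← degW, mul_div_mul_right _ _ (hdne z')]
    simp only [this]
    rw [← Finset.sum_div, ← degW, div_self (hdne x)]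
  · rintro ⟨z', x'⟩
    simp only [K, p, Fintype.sum_prod_type_right]
    have : ∀ x, ∑ z, adjW G z x * (adjW G x z' * adjW G z' x' / (degW G x * degW G z'))
        = adjW G z' x * (adjW G z' x' / degW G z') := by
      intro x
      rw [← Finset.sum_mul]
      simp only [adjW_comm G _ x]
      rw [← degW, adjW_comm G x z']
      have := hdne x; have := hdne z'
      field_simp
    simp only [this]
    rw [← Finset.sum_mul, ← degW, mul_div_cancel₀ _ (hdne z')]
  · intro _
    rw [hptot]
    -- A bad step contains a cherry with heavy ends, centred at `x` or at `z'`; each kind is summed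
    -- by `hlight` at its centre.
    have hle : ∀ a b, p a * (if good a b then 0 else K a b)
        ≤ adjW G a.2 a.1 * adjW G a.2 b.1 * heavyW G L δ a.1 b.1 * adjW G b.1 b.2
            / (degW G a.2 * degW G b.1)
          + adjW G b.1 a.2 * adjW G b.1 b.2 * heavyW G L δ a.2 b.2 * adjW G a.2 a.1
            / (degW G a.2 * degW G b.1) := by
      rintro ⟨z, x⟩ ⟨z', x'⟩
      have t1 : 0 ≤ adjW G x z * adjW G x z' * adjW G z' x' / (degW G x * degW G z') := by
        have := hd0 x; have := hd0 z'; have := hA0 x z; have := hA0 x z'; have := hA0 z' x'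
        positivity
      have h1 := heavyW_nonneg G (L := L) (δ := δ) z z'
      have h2 := heavyW_nonneg G (L := L) (δ := δ) x x'
      have e : ∀ h : ℝ, adjW G x z * adjW G x z' * h * adjW G z' x' / (degW G x * degW G z')
          = h * (adjW G x z * adjW G x z' * adjW G z' x' / (degW G x * degW G z')) := by
        intro h; ring
      have e' : ∀ h : ℝ, adjW G z' x * adjW G z' x' * h * adjW G x z / (degW G x * degW G z')
          = h * (adjW G x z * adjW G x z' * adjW G z' x' / (degW G x * degW G z')) := by
        intro h; rw [adjW_comm G z' x]; ring
      have e'' : p (z, x) * K (z, x) (z', x')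
          = adjW G x z * adjW G x z' * adjW G z' x' / (degW G x * degW G z') := by
        simp only [p, K]; rw [adjW_comm G z x]; ring
      simp only
      rw [e, e']
      split_ifs with hg
      · rw [mul_zero]; positivity
      · rw [e'']
        simp only [good, not_and_or, not_not] at hg
        rcases hg with hg | hg
        · have : heavyW G L δ z z' = 1 := if_pos hg
          rw [this]
          nlinarith
        · have : heavyW G L δ x x' = 1 := if_pos hg
          rw [this]
          nlinarith
    have hb : ∀ a, (∑ x, ∑ y, adjW G a x * adjW G a y * heavyW G L δ x y) / degW G a
        ≤ ε * degW G a := by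
      intro a
      rw [div_le_iff₀ (hd0 a)]
      calc _ ≤ _ := hlight a
        _ = _ := by ring
    calc _ ≤ _ := Finset.sum_le_sum fun a _ => Finset.sum_le_sum fun b _ => hle a b
      _ = ∑ x, (∑ z, ∑ z', adjW G x z * adjW G x z' * heavyW G L δ z z') / degW G x
          + ∑ z', (∑ x, ∑ x', adjW G z' x * adjW G z' x' * heavyW G L δ x x') / degW G z' := by
        simp only [Finset.sum_add_distrib, Fintype.sum_prod_type]
        congr 1
        · rw [Finset.sum_comm]
          refine Finset.sum_congr rfl fun x _ => ?_
          rw [Finset.sum_div]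
          refine Finset.sum_congr rfl fun z _ => ?_
          rw [Finset.sum_div]
          refine Finset.sum_congr rfl fun z' _ => ?_
          rw [← Finset.sum_div, ← Finset.mul_sum, ← degW, mul_div_mul_right _ _ (hdne z')]
        · calc _ = ∑ x, ∑ z, ∑ z', ∑ x', adjW G z' x * adjW G z' x' * heavyW G L δ x x' *
                adjW G x z / (degW G x * degW G z') := Finset.sum_comm
            _ = ∑ x, ∑ z', ∑ x', ∑ z, adjW G z' x * adjW G z' x' * heavyW G L δ x x' *
                adjW G x z / (degW G x * degW G z') := by
              refine Finset.sum_congr rfl fun x _ => ?_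
              rw [Finset.sum_comm]
              exact Finset.sum_congr rfl fun z' _ => Finset.sum_comm
            _ = _ := by
              rw [Finset.sum_comm]
              refine Finset.sum_congr rfl fun z' _ => ?_
              rw [Finset.sum_div]
              refine Finset.sum_congr rfl fun x _ => ?_
              rw [Finset.sum_div]
              refine Finset.sum_congr rfl fun x' _ => ?_
              rw [← Finset.sum_div, ← Finset.mul_sum, ← degW, mul_comm (degW G x),
                mul_div_mul_right _ _ (hdne x)]
      _ ≤ ∑ x, ε * degW G x + ∑ x, ε * degW G x :=
        add_le_add (Finset.sum_le_sum fun a _ => hb a) (Finset.sum_le_sum fun a _ => hb a)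
      _ = _ := by rw [← Finset.mul_sum]; ring
  · rintro u ⟨z₀, x⟩ ⟨z, x₄⟩ B hB
    rcases B.eq_empty_or_nonempty with rfl | ⟨y₀, hy₀⟩
    · rw [Finset.sum_empty]; exact hβ0 _ _
    -- With the first entry `u` of the hole fixed, the sum over `y` is a codegree of `u` and `z`,
    -- and goodness of the second transition makes this pair light. When the second entry is fixed,
    -- the first transition plays this role.
    have hl := codegW_div_le_of_not_isHeavyPair G hδ hL (hdeg u) (hdeg z) (hB y₀ hy₀).2.1
    have hterm : ∀ y, K (z₀, x) (u, y) * K (u, y) (z, x₄)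
        ≤ adjW G u y * adjW G y z * (adjW G z x₄ / (degW G x * degW G u * δ * degW G z)) := by
      intro y
      simp only [K]
      have h1 := hd0 x; have h2 := hd0 u; have h3 := hd0 z; have h4 := hd0 y
      have a1 := hA0 u y; have a2 := hA0 y z; have a3 := hA0 z x₄
      calc _ = adjW G x u * (adjW G u y * adjW G y z * (adjW G z x₄ /
            (degW G x * degW G u * degW G y * degW G z))) := by field_simp
        _ ≤ adjW G u y * adjW G y z * (adjW G z x₄ /
            (degW G x * degW G u * degW G y * degW G z)) :=
          mul_le_of_le_one_left (by positivity) (adjW_le_one G _ _)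
        _ ≤ _ := by
          have := hdeg y
          gcongr
    calc _ ≤ ∑ y ∈ B, adjW G u y * adjW G y z *
            (adjW G z x₄ / (degW G x * degW G u * δ * degW G z)) :=
          Finset.sum_le_sum fun y _ => hterm y
      _ ≤ ∑ y, adjW G u y * adjW G y z *
            (adjW G z x₄ / (degW G x * degW G u * δ * degW G z)) := by
          refine Finset.sum_le_univ_sum_of_nonneg fun y => ?_
          have h1 := hd0 x; have h2 := hd0 u; have h3 := hd0 z
          have a1 := hA0 u y; have a2 := hA0 y z; have a3 := hA0 z x₄
          positivity
      _ = adjW G z x₄ / (degW G x * δ) * (codegW G u z / (degW G u * degW G z)) := by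
          rw [← Finset.sum_mul, ← codegW]
          have h1 := hdne x; have h2 := hdne u; have h3 := hdne z
          field_simp
      _ ≤ adjW G z x₄ / (degW G x * δ) * (L / δ ^ 2) := by
          have h1 := hd0 x; have a3 := hA0 z x₄
          exact mul_le_mul_of_nonneg_left hl (by positivity)
      _ = adjW G z x₄ * (L / δ ^ 3 * (1 / degW G x)) := by
          have h1 := hdne x
          field_simp
      _ ≤ _ := by
          simp only [β]
          have h1 := hd0 z; have a3 := hA0 z x₄
          refine mul_le_mul_of_nonneg_left (mul_le_mul_of_nonneg_left ?_ (by positivity)) a3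
          have : 0 < 1 / degW G z := by positivity
          linarith
  · rintro u ⟨z₀, x⟩ ⟨z, x₄⟩ B hB
    rcases B.eq_empty_or_nonempty with rfl | ⟨y₀, hy₀⟩
    · rw [Finset.sum_empty]; exact hβ0 _ _
    have hl := codegW_div_le_of_not_isHeavyPair G hδ hL (hdeg x) (hdeg u) (hB y₀ hy₀).1.2
    have hterm : ∀ y, K (z₀, x) (y, u) * K (y, u) (z, x₄)
        ≤ adjW G x y * adjW G y u * (adjW G z x₄ / (degW G x * δ * degW G u * degW G z)) := by
      intro y
      simp only [K]
      have h1 := hd0 x; have h2 := hd0 u; have h3 := hd0 z; have h4 := hd0 y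
      have a1 := hA0 x y; have a2 := hA0 y u; have a3 := hA0 z x₄
      calc _ = adjW G u z * (adjW G x y * adjW G y u * (adjW G z x₄ /
            (degW G x * degW G y * degW G u * degW G z))) := by field_simp
        _ ≤ adjW G x y * adjW G y u * (adjW G z x₄ /
            (degW G x * degW G y * degW G u * degW G z)) :=
          mul_le_of_le_one_left (by positivity) (adjW_le_one G _ _)
        _ ≤ _ := by
          have := hdeg y
          gcongr
    calc _ ≤ ∑ y ∈ B, adjW G x y * adjW G y u *
            (adjW G z x₄ / (degW G x * δ * degW G u * degW G z)) :=
          Finset.sum_le_sum fun y _ => hterm y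
      _ ≤ ∑ y, adjW G x y * adjW G y u *
            (adjW G z x₄ / (degW G x * δ * degW G u * degW G z)) := by
          refine Finset.sum_le_univ_sum_of_nonneg fun y => ?_
          have h1 := hd0 x; have h2 := hd0 u; have h3 := hd0 z
          have a1 := hA0 x y; have a2 := hA0 y u; have a3 := hA0 z x₄
          positivity
      _ = adjW G z x₄ / (degW G z * δ) * (codegW G x u / (degW G x * degW G u)) := by
          rw [← Finset.sum_mul, ← codegW]
          have h1 := hdne x; have h2 := hdne u; have h3 := hdne z
          field_simp
      _ ≤ adjW G z x₄ / (degW G z * δ) * (L / δ ^ 2) := by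
          have h1 := hd0 z; have a3 := hA0 z x₄
          exact mul_le_mul_of_nonneg_left hl (by positivity)
      _ = adjW G z x₄ * (L / δ ^ 3 * (1 / degW G z)) := by
          have h1 := hdne z
          field_simp
      _ ≤ _ := by
          simp only [β]
          have h1 := hd0 x; have a3 := hA0 z x₄
          refine mul_le_mul_of_nonneg_left (mul_le_mul_of_nonneg_left ?_ (by positivity)) a3
          have : 0 < 1 / degW G x := by positivity
          linarith
  -- Over directed edges, the reciprocals of the degrees of the starting points sum to the number of
  -- vertices; hence the loss is of order `n / δ ^ 3`.
  · have hone : ∑ a : V × V, adjW G a.1 a.2 * (1 / degW G a.1) = Fintype.card V := by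
      have : ∀ x, ∑ y, adjW G x y * (1 / degW G x) = 1 := fun x => by
        rw [← Finset.sum_mul, ← degW, mul_one_div, div_self (hdne x)]
      rw [Fintype.sum_prod_type]
      simp only [this]
      simp
    have hone' : ∑ a : V × V, adjW G a.1 a.2 * (1 / degW G a.2) = Fintype.card V := by
      rw [← hone, Fintype.sum_prod_type, Fintype.sum_prod_type_right]
      exact Finset.sum_congr rfl fun x _ => Finset.sum_congr rfl fun y _ => by rw [adjW_comm]
    refine le_of_eq ?_
    calc ∑ a, ∑ d, p a * β a d
        = ∑ a, ∑ d, (L / δ ^ 3 * (adjW G a.1 a.2 * (1 / degW G a.2) * p d)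
            + L / δ ^ 3 * (p a * (adjW G d.1 d.2 * (1 / degW G d.1)))) := by
          refine Finset.sum_congr rfl fun a _ => Finset.sum_congr rfl fun d _ => ?_
          simp only [p, β]; ring
      _ = _ := by
          simp only [Finset.sum_add_distrib, ← Finset.mul_sum, ← Finset.sum_mul, hone, hone']
          ring
  · rw [hptot]
    exact Finset.sum_pos (fun x _ => hd0 x) Finset.univ_nonempty

end Weights

/-! ### The heavy case: walking along heavy pairs. -/

/-- A dense symmetric weight restricts to a subset with large minimum degree. -/
theorem exists_subset_degree_ge {V : Type*} [DecidableEq V] (h : V → V → ℝ)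
    (h0 : ∀ x y, 0 ≤ h x y) (hsymm : ∀ x y, h x y = h y x) (X : Finset V) {θ : ℝ}
    (hX : 2 * θ * X.card < ∑ x ∈ X, ∑ y ∈ X, h x y) :
    ∃ Y ⊆ X, Y.Nonempty ∧ ∀ x ∈ Y, θ ≤ ∑ y ∈ Y, h x y := by
  -- At a maximiser, deleting `x` loses at most twice the degree of `x` and gains `2 * θ`, so the
  -- degree is at least `θ`.
  let φ : Finset V → ℝ := fun Y => ∑ x ∈ Y, ∑ y ∈ Y, h x y - 2 * θ * Y.card
  obtain ⟨Y, hYX, hmax⟩ := X.powerset.exists_max_image φ ⟨X, Finset.mem_powerset_self X⟩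
  rw [Finset.mem_powerset] at hYX
  have hφ : 0 < φ Y := lt_of_lt_of_le (by simp only [φ]; linarith)
    (hmax X (Finset.mem_powerset_self X))
  refine ⟨Y, hYX, ?_, ?_⟩
  · rw [Finset.nonempty_iff_ne_empty]
    rintro rfl
    simp [φ] at hφ
  · intro x hx
    have h1 := hmax (Y.erase x) (Finset.mem_powerset.2 ((Finset.erase_subset _ _).trans hYX))
    have e1 : ∑ u ∈ Y, ∑ y ∈ Y, h u y = ∑ y ∈ Y, h x y + ∑ u ∈ Y.erase x, ∑ y ∈ Y, h u y :=
      (Finset.add_sum_erase _ _ hx).symm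
    have e2 : ∑ u ∈ Y.erase x, ∑ y ∈ Y, h u y
        = ∑ u ∈ Y.erase x, h u x + ∑ u ∈ Y.erase x, ∑ y ∈ Y.erase x, h u y := by
      rw [← Finset.sum_add_distrib]
      exact Finset.sum_congr rfl fun u _ => (Finset.add_sum_erase _ _ hx).symm
    have e3 : ∑ u ∈ Y.erase x, h u x ≤ ∑ y ∈ Y, h x y := by
      simp only [hsymm _ x]
      exact Finset.sum_le_sum_of_subset_of_nonneg (Finset.erase_subset _ _) fun y _ _ => h0 x y
    have e4 : (Y.card : ℝ) = (Y.erase x).card + 1 := by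
      exact_mod_cast (Finset.card_erase_add_one hx).symm
    simp only [φ] at h1
    rw [e1, e2, e4] at h1
    linarith

section Heavy

variable {V : Type*} [Fintype V] {G : SimpleGraph V} {L δ : ℝ}

theorem heavyW_comm (x y : V) : heavyW G L δ x y = heavyW G L δ y x := by
  have : IsHeavyPair G L δ x y ↔ IsHeavyPair G L δ y x := by
    rw [IsHeavyPair, IsHeavyPair, max_comm, codegW_comm]
  by_cases h : IsHeavyPair G L δ x y
  · rw [heavyW, heavyW, if_pos h, if_pos (this.1 h)]
  · rw [heavyW, heavyW, if_neg h, if_neg (mt this.2 h)]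

theorem heavyW_le_one (x y : V) : heavyW G L δ x y ≤ 1 := by
  rw [heavyW]; split_ifs <;> norm_num

theorem heavyW_div_codegW_mul_codegW (hδ : 0 < δ) (hL : 0 < L) (hdeg : ∀ x, δ ≤ degW G x)
    (x y : V) : heavyW G L δ x y / codegW G x y * codegW G x y = heavyW G L δ x y := by
  rw [heavyW]
  split_ifs with h
  · refine div_mul_cancel₀ _ (ne_of_gt (lt_trans ?_ h))
    have : 0 < max (degW G x) (degW G y) := lt_max_of_lt_left (hδ.trans_le (hdeg x))
    positivity
  · simp

theorem heavyW_div_codegW_le (hδ : 0 < δ) (hL : 0 < L) (hdeg : ∀ x, δ ≤ degW G x)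
    (x y : V) : heavyW G L δ x y / codegW G x y ≤ δ / L / degW G y := by
  have hy : 0 < degW G y := hδ.trans_le (hdeg y)
  rw [heavyW]
  split_ifs with h
  · have h1 : L / δ * degW G y ≤ codegW G x y :=
      (mul_le_mul_of_nonneg_left (le_max_right _ _) (by positivity)).trans h.le
    calc 1 / codegW G x y ≤ 1 / (L / δ * degW G y) :=
          one_div_le_one_div_of_le (by positivity) h1
      _ = _ := by field_simp
  · rw [zero_div]; positivity

/-- Here `y` is the size of the heavy set and `S` its total heavy degree: both charges are
proportional to `S`, with no dependence on the number of vertices. -/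
theorem heavy_charge_le {η L D δ S y : ℝ} (hη : 0 < η) (hL : 0 < L) (hD : 0 < D)
    (hδD : δ ≤ D) (hy : 0 ≤ y) (hyD : y ≤ D) (hS : 0 ≤ S) (hyS : y * (η * D) ≤ S) :
    (1 / (η * D * L) * S + δ / (η * D * L) * y) * y ≤ (1 / (η * L) + 1 / (η ^ 2 * L)) * S := by
  have e1 : 1 / (η * D * L) * S * y ≤ 1 / (η * L) * S := by
    calc _ ≤ 1 / (η * D * L) * S * D := by gcongr
      _ = _ := by field_simp
  have e2 : δ / (η * D * L) * y * y ≤ 1 / (η ^ 2 * L) * S := by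
    calc _ ≤ D / (η * D * L) * y * D := by gcongr
      _ = 1 / (η ^ 2 * L) * (y * (η * D)) := by field_simp
      _ ≤ _ := by gcongr
  linarith

set_option maxHeartbeats 400000 in
/-- Honeycombs from a set of vertices most pairs of which are heavy: choose independent vertices of
the set and connect them by common neighbours. -/
theorem honeycombGraph_isContained_of_heavy [DecidableEq V] {k ℓ M : ℕ} (hk : Odd k)
    (hM : (ℓ + 2) * (2 * (k + 2)) ≤ M) (hδ : 0 < δ) (hdeg : ∀ x, δ ≤ degW G x)
    (hL : 0 < L) {η D : ℝ} (hη : 0 < η) (Y : Finset V) (hYne : Y.Nonempty) (hδD : δ ≤ D)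
    (hYD : (Y.card : ℝ) ≤ D) (hY : ∀ x ∈ Y, η * D ≤ ∑ y ∈ Y, heavyW G L δ x y)
    (hlt : (k + 2) * (2 * M * (1 / (η * L) + 1 / (η ^ 2 * L))) < 1) :
    (honeycombGraph k ℓ).IsContained G := by
  have hA0 := adjW_nonneg G
  have hD : 0 < D := hδ.trans_le hδD
  have hd0 : ∀ x, 0 < degW G x := fun x => hδ.trans_le (hdeg x)
  let iY : V → ℝ := fun x => if x ∈ Y then 1 else 0
  have iY0 : ∀ x, 0 ≤ iY x := fun x => by simp only [iY]; split_ifs <;> norm_num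
  have iY1 : ∀ x, iY x ≤ 1 := fun x => by simp only [iY]; split_ifs <;> norm_num
  let h : V → V → ℝ := fun x y => iY x * iY y * heavyW G L δ x y
  have h0 : ∀ x y, 0 ≤ h x y := fun x y =>
    mul_nonneg (mul_nonneg (iY0 _) (iY0 _)) (heavyW_nonneg G x y)
  have h1 : ∀ x y, h x y ≤ 1 := fun x y =>
    mul_le_one₀ (mul_le_one₀ (iY1 _) (iY0 _) (iY1 _)) (heavyW_nonneg G x y) (heavyW_le_one x y)
  have hcomm : ∀ x y, h x y = h y x := fun x y => by
    simp only [h]; rw [heavyW_comm x y]; ring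
  let E : V → ℝ := fun x => ∑ y, h x y
  have hEY : ∀ x ∈ Y, η * D ≤ E x := by
    intro x hx
    refine (hY x hx).trans (le_of_eq ?_)
    simp only [E, h, iY, if_pos hx, one_mul, ite_mul, zero_mul]
    rw [Finset.sum_ite_mem, Finset.univ_inter]
  have hEn : ∀ x ∉ Y, E x = 0 := by
    intro x hx
    simp [E, h, iY, hx]
  have hE0 : ∀ x, 0 ≤ E x := fun x => Finset.sum_nonneg fun y _ => h0 x y
  let r : V → V → ℝ := fun x y => h x y / codegW G x y
  have r0 : ∀ x y, 0 ≤ r x y := fun x y => div_nonneg (h0 x y) (codegW_nonneg G x y)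
  have rc : ∀ x y, r x y * codegW G x y = h x y := by
    intro x y
    simp only [r, h]
    rw [mul_div_assoc, mul_assoc, heavyW_div_codegW_mul_codegW hδ hL hdeg]
  have rle : ∀ x y, r x y ≤ iY x * iY y * (δ / L / degW G y) := by
    intro x y
    simp only [r, h]
    rw [mul_div_assoc]
    exact mul_le_mul_of_nonneg_left (heavyW_div_codegW_le hδ hL hdeg x y)
      (mul_nonneg (iY0 _) (iY0 _))
  have rleL : ∀ x y, r x y ≤ iY y * (1 / L) := by
    intro x y
    refine (rle x y).trans ?_
    have hd : δ / L / degW G y ≤ 1 / L := by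
      rw [div_div, div_le_div_iff₀ (mul_pos hL (hd0 y)) hL]
      nlinarith [hdeg y]
    have := hd0 y
    refine mul_le_mul ?_ hd (by positivity) (iY0 y)
    exact mul_le_of_le_one_left (iY0 y) (iY1 x)
  have rE : ∀ x y, E x * (r x y / E x) = r x y := by
    intro x y
    by_cases hx : x ∈ Y
    · exact mul_div_cancel₀ _ (lt_of_lt_of_le (by positivity) (hEY x hx)).ne'
    · simp [r, h, iY, hx]
  have rdivE : ∀ y z, iY y * r y z / E y ≤ r y z / (η * D) := by
    intro y z
    by_cases hy : y ∈ Y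
    · have := hEY y hy
      have := r0 y z
      simp only [iY, if_pos hy, one_mul]
      gcongr
    · have := r0 y z
      simp only [iY, if_neg hy, zero_mul, zero_div]
      positivity
  -- Random walk on the heavy graph `h` on `Y`, with a uniform common neighbour `z` inserted at each
  -- step; the law of `x` is proportional to the heavy degree `E`.
  let p : V × V → ℝ := fun a => ∑ w, r w a.2 * (adjW G w a.1 * adjW G a.1 a.2)
  have p0 : ∀ a, 0 ≤ p a := fun a =>
    Finset.sum_nonneg fun w _ => mul_nonneg (r0 _ _) (mul_nonneg (hA0 _ _) (hA0 _ _))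
  have psum : ∀ x, ∑ z, p (z, x) = E x := by
    intro x
    simp only [p]
    rw [Finset.sum_comm]
    refine Finset.sum_congr rfl fun w _ => ?_
    rw [← Finset.mul_sum, ← codegW, rc, hcomm]
  have ptot : ∑ a, p a = ∑ x, E x := by
    rw [Fintype.sum_prod_type_right]
    exact Finset.sum_congr rfl fun x _ => psum x
  have hEtot : Y.card * (η * D) ≤ ∑ x, E x := by
    rw [← nsmul_eq_mul]
    exact (Finset.card_nsmul_le_sum _ _ _ hEY).trans
      (Finset.sum_le_univ_sum_of_nonneg hE0)
  have hYpos : (0 : ℝ) < Y.card := by exact_mod_cast hYne.card_pos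
  have hEpos : 0 < ∑ x, E x := lt_of_lt_of_le (by positivity) hEtot
  let K : V × V → V × V → ℝ := fun a b =>
    r a.2 b.2 / E a.2 * (adjW G a.2 b.1 * adjW G b.1 b.2)
  have K0 : ∀ a b, 0 ≤ K a b := fun a b =>
    mul_nonneg (div_nonneg (r0 _ _) (hE0 _)) (mul_nonneg (hA0 _ _) (hA0 _ _))
  -- `β₁` pays for holes with fixed common neighbour, where `y` ranges over heavy partners; `β₂`
  -- pays for holes with fixed vertex of `Y`, where summing over common neighbours cancels the
  -- codegree in `r`.
  let β₁ : V × V → V × V → ℝ := fun a d => 1 / E a.2 * (1 / (η * D * L) * p d)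
  let β₂ : V × V → V × V → ℝ := fun a d =>
    1 / E a.2 * (δ / (η * D * L) * (iY d.2 * (adjW G d.1 d.2 / degW G d.2)))
  have β₁0 : ∀ a d, 0 ≤ β₁ a d := fun a d => by
    have := hE0 a.2; have := p0 d; positivity
  have β₂0 : ∀ a d, 0 ≤ β₂ a d := fun a d => by
    have := hE0 a.2; have := iY0 d.2; have := hA0 d.1 d.2; have := hd0 d.2; positivity
  refine honeycombGraph_isContained_of_chain hk hM p K (fun a d => β₁ a d + β₂ a d)
    (fun _ _ => True) (ε := 0) (c := 1 / (η * L) + 1 / (η ^ 2 * L)) ?_ p0 K0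
    (fun a d => add_nonneg (β₁0 a d) (β₂0 a d)) ?_ ?_ ?_ ?_ ?_ ?_ (by rwa [ptot])
    (by rwa [zero_add]) le_rfl (by positivity)
  · intro a b hab
    have h1 : 0 < adjW G a.2 b.1 := by
      refine lt_of_le_of_ne (hA0 _ _) fun h => ?_
      simp only [K, ← h, zero_mul, mul_zero, lt_irrefl] at hab
    have h2 : 0 < adjW G b.1 b.2 := by
      refine lt_of_le_of_ne (hA0 _ _) fun h => ?_
      simp only [K, ← h, mul_zero, lt_irrefl] at hab
    exact ⟨(adjW_pos G).1 h1, (adjW_pos G).1 h2⟩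
  · rintro ⟨z, x⟩
    simp only [K, Fintype.sum_prod_type_right]
    have : ∀ x', ∑ z', r x x' / E x * (adjW G x z' * adjW G z' x') = h x x' / E x := by
      intro x'
      rw [← Finset.mul_sum, ← codegW, div_mul_eq_mul_div, rc]
    simp only [this]
    rw [← Finset.sum_div]
    -- Off `Y` the row vanishes, since `E x = 0` and division by zero gives zero.
    exact div_self_le_one _
  · rintro ⟨z', x'⟩
    simp only [K, Fintype.sum_prod_type_right]
    simp only [← Finset.sum_mul, psum, p]
    refine Finset.sum_congr rfl fun x _ => ?_
    rw [← mul_assoc, rE]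
  · intro _
    simp
  · rintro u ⟨z₀, x₁⟩ ⟨z₃, x₃⟩ B -
    have hterm : ∀ y, K (z₀, x₁) (u, y) * K (u, y) (z₃, x₃)
        ≤ 1 / E x₁ * (1 / (η * D * L) * (r y x₃ * (adjW G y z₃ * adjW G z₃ x₃))) := by
      intro y
      have a1 := hA0 y z₃; have a2 := hA0 z₃ x₃
      have b1 := hE0 x₁; have b2 := hE0 y; have b3 := r0 y x₃; have b4 := r0 x₁ y
      have c1 : adjW G x₁ u * adjW G u y ≤ 1 :=
        mul_le_one₀ (adjW_le_one G _ _) (hA0 _ _) (adjW_le_one G _ _)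
      calc K (z₀, x₁) (u, y) * K (u, y) (z₃, x₃)
          = adjW G x₁ u * adjW G u y * (1 / E x₁ * (r x₁ y * (r y x₃ / E y) *
              (adjW G y z₃ * adjW G z₃ x₃))) := by simp only [K]; ring
        _ ≤ 1 / E x₁ * (r x₁ y * (r y x₃ / E y) * (adjW G y z₃ * adjW G z₃ x₃)) :=
            mul_le_of_le_one_left (by positivity) c1
        _ ≤ 1 / E x₁ * (1 / (η * D * L) * r y x₃ * (adjW G y z₃ * adjW G z₃ x₃)) := by
            refine mul_le_mul_of_nonneg_left (mul_le_mul_of_nonneg_right ?_ (by positivity))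
              (by positivity)
            calc r x₁ y * (r y x₃ / E y) ≤ iY y * (1 / L) * (r y x₃ / E y) :=
                  mul_le_mul_of_nonneg_right (rleL _ _) (by positivity)
              _ = 1 / L * (iY y * r y x₃ / E y) := by ring
              _ ≤ 1 / L * (r y x₃ / (η * D)) :=
                  mul_le_mul_of_nonneg_left (rdivE y x₃) (by positivity)
              _ = _ := by field_simp
        _ = _ := by ring
    refine le_trans ?_ (le_add_of_nonneg_right (β₂0 _ _))
    calc _ ≤ _ := Finset.sum_le_sum fun y _ => hterm y
      _ ≤ ∑ y, 1 / E x₁ * (1 / (η * D * L) * (r y x₃ * (adjW G y z₃ * adjW G z₃ x₃))) :=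
          Finset.sum_le_univ_sum_of_nonneg fun y => (mul_nonneg (K0 _ _) (K0 _ _)).trans (hterm y)
      _ = _ := by simp only [β₁, p, Finset.mul_sum]
  · rintro u ⟨z₀, x₁⟩ ⟨z₃, x₃⟩ B -
    refine le_trans ?_ (le_add_of_nonneg_left (β₁0 _ _))
    have a1 := hA0 u z₃; have a2 := hA0 z₃ x₃
    have b1 := hE0 x₁; have b2 := hE0 u; have b3 := r0 u x₃; have b4 := h0 x₁ u
    have d3 := hd0 x₃
    calc ∑ y ∈ B, K (z₀, x₁) (y, u) * K (y, u) (z₃, x₃)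
        ≤ ∑ y, K (z₀, x₁) (y, u) * K (y, u) (z₃, x₃) :=
          Finset.sum_le_univ_sum_of_nonneg fun y => mul_nonneg (K0 _ _) (K0 _ _)
      _ = 1 / E x₁ * (h x₁ u * (r u x₃ / E u) * (adjW G u z₃ * adjW G z₃ x₃)) := by
          rw [← rc, codegW]
          simp only [K, Finset.mul_sum, Finset.sum_mul]
          exact Finset.sum_congr rfl fun y _ => by ring
      _ ≤ 1 / E x₁ * (δ / (η * D * L) * (iY x₃ / degW G x₃) * (1 * adjW G z₃ x₃)) := by
          refine mul_le_mul_of_nonneg_left (mul_le_mul ?_ ?_ (by positivity) ?_) (by positivity)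
          · calc h x₁ u * (r u x₃ / E u) ≤ iY u * (r u x₃ / E u) := by
                  refine mul_le_mul_of_nonneg_right ?_ (by positivity)
                  simp only [h]
                  have := iY0 u; have := iY1 x₁; have := iY0 x₁
                  calc _ ≤ iY x₁ * iY u :=
                        mul_le_of_le_one_right (by positivity) (heavyW_le_one _ _)
                    _ ≤ _ := mul_le_of_le_one_left (iY0 u) (iY1 x₁)
              _ = iY u * r u x₃ / E u := by ring
              _ ≤ r u x₃ / (η * D) := rdivE u x₃
              _ ≤ (iY u * iY x₃ * (δ / L / degW G x₃)) / (η * D) := by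
                  have := rle u x₃
                  gcongr
              _ ≤ (1 * iY x₃ * (δ / L / degW G x₃)) / (η * D) := by
                  have := iY1 u; have := iY0 x₃
                  gcongr
              _ = _ := by field_simp
          · exact mul_le_mul_of_nonneg_right (adjW_le_one G _ _) a2
          · have := iY0 x₃
            positivity
      _ = _ := by simp only [β₂]; ring
  · have s1 : ∑ a : V × V, p a * (1 / E a.2) ≤ Y.card := by
      rw [Fintype.sum_prod_type_right]
      simp only [← Finset.sum_mul, psum]
      calc ∑ x, E x * (1 / E x) ≤ ∑ x, iY x := by
            refine Finset.sum_le_sum fun x _ => ?_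
            by_cases hx : x ∈ Y
            · simp only [iY, if_pos hx, mul_one_div]
              exact div_self_le_one _
            · simp [iY, hx, hEn x hx]
        _ = _ := by simp [iY]
    have s10 : 0 ≤ ∑ a : V × V, p a * (1 / E a.2) := Finset.sum_nonneg fun a _ =>
      mul_nonneg (p0 a) (one_div_nonneg.2 (hE0 _))
    have s2 : ∑ d : V × V, iY d.2 * (adjW G d.1 d.2 / degW G d.2) = Y.card := by
      rw [Fintype.sum_prod_type_right]
      have : ∀ x, ∑ z, iY x * (adjW G z x / degW G x) = iY x := by
        intro x
        rw [← Finset.mul_sum, ← Finset.sum_div]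
        simp only [adjW_comm G _ x]
        rw [← degW, div_self (hd0 x).ne', mul_one]
      simp only [this]
      simp [iY]
    calc ∑ a, ∑ d, p a * (β₁ a d + β₂ a d)
        = ∑ a, ∑ d, (1 / (η * D * L) * (p a * (1 / E a.2) * p d)
            + δ / (η * D * L) * (p a * (1 / E a.2) *
              (iY d.2 * (adjW G d.1 d.2 / degW G d.2)))) := by
          refine Finset.sum_congr rfl fun a _ => Finset.sum_congr rfl fun d _ => ?_
          simp only [β₁, β₂]; ring
      _ = (1 / (η * D * L) * ∑ a, p a + δ / (η * D * L) * Y.card) *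
            ∑ a : V × V, p a * (1 / E a.2) := by
          simp only [Finset.sum_add_distrib, ← Finset.mul_sum, ← Finset.sum_mul, s2]
          ring
      _ ≤ (1 / (η * D * L) * ∑ a, p a + δ / (η * D * L) * Y.card) * Y.card := by
          refine mul_le_mul_of_nonneg_left s1 ?_
          have := Finset.sum_nonneg fun a (_ : a ∈ Finset.univ) => p0 a
          positivity
      _ ≤ _ := by
          rw [ptot]
          exact heavy_charge_le hη hL hD hδD hYpos.le hYD hEpos.le hEtot

end Heavy

/-! ### The upper bound. -/

theorem honeycombGraph_isContained_of_minDegree {k : ℕ} (ℓ : ℕ) (hk : Odd k) :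
    ∃ C : ℝ, 0 < C ∧ ∀ (V : Type) [Fintype V] [Nonempty V] (G : SimpleGraph V) (δ : ℝ), 0 < δ →
      (∀ x, δ ≤ degW G x) → C * Fintype.card V ≤ δ ^ 3 → (honeycombGraph k ℓ).IsContained G := by
  obtain ⟨M, hM⟩ : ∃ M : ℕ, M = (ℓ + 2) * (2 * (k + 2)) := ⟨_, rfl⟩
  have hM0 : (0 : ℝ) < M := by rw [hM]; positivity
  set κ : ℝ := k + 2 with hκ
  have hκ0 : 0 < κ := by positivity
  -- In the light case bad steps cost `1/4`, and the constant `8 * κ * M * L` limits the charges to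
  -- `1/2`. The value `η = ε / 2` absorbs the factor `2` of `exists_subset_degree_ge`, and `L` is
  -- chosen so that the heavy condition becomes `(L - 1) / L < 1`.
  set ε : ℝ := 1 / (8 * κ) with hε
  have hε0 : 0 < ε := by positivity
  set η : ℝ := ε / 2 with hη
  have hη0 : 0 < η := by positivity
  set L : ℝ := 1 + κ * (2 * M * (1 / η + 1 / η ^ 2)) with hL
  have hL0 : 0 < L := by positivity
  refine ⟨8 * κ * M * L, by positivity, ?_⟩
  intro V _ _ G δ hδ hdeg hC
  classical
  by_cases hlight : ∀ a, ∑ x, ∑ y, adjW G a x * adjW G a y * heavyW G L δ x y ≤ ε * degW G a ^ 2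
  · refine honeycombGraph_isContained_of_light G hk hM.ge hδ hdeg hL0.le hε0.le hlight ?_
    have h1 : κ * (2 * ε) = 1 / 4 := by rw [hε]; field_simp; norm_num
    have h2 : κ * (2 * M * (2 * Fintype.card V * L / δ ^ 3)) ≤ 1 / 2 := by
      have e : κ * (2 * M * (2 * Fintype.card V * L / δ ^ 3))
          = (8 * κ * M * L * Fintype.card V) / δ ^ 3 / 2 := by ring
      rw [e]
      have : (8 * κ * M * L * Fintype.card V) / δ ^ 3 ≤ 1 := (div_le_one (by positivity)).2 hC
      linarith
    rw [← hκ, mul_add]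
    linarith
  · push Not at hlight
    obtain ⟨b, hb⟩ := hlight
    set X : Finset V := Finset.univ.filter (G.Adj b) with hX
    have hadj : ∀ x, adjW G b x = if x ∈ X then 1 else 0 := by
      intro x
      by_cases h : G.Adj b x
      · rw [adjW, if_pos h, if_pos (by simp [hX, h])]
      · rw [adjW, if_neg h, if_neg (by simp [hX, h])]
    have hXc : (X.card : ℝ) = degW G b := by
      simp [degW, hadj]
    have hsum : ∑ x, ∑ y, adjW G b x * adjW G b y * heavyW G L δ x y
        = ∑ x ∈ X, ∑ y ∈ X, heavyW G L δ x y := by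
      simp only [hadj, ite_mul, one_mul, zero_mul]
      rw [← Finset.sum_filter_add_sum_filter_not Finset.univ (· ∈ X)]
      rw [Finset.sum_eq_zero (s := Finset.univ.filter fun x => x ∉ X) fun x hx => by
        simp [(Finset.mem_filter.1 hx).2]]
      simp only [Finset.filter_univ_mem, add_zero]
      refine Finset.sum_congr rfl fun x hx => ?_
      simp [hx]
    have hdb : 0 < degW G b := hδ.trans_le (hdeg b)
    obtain ⟨Y, hYX, hYne, hY⟩ := exists_subset_degree_ge (heavyW G L δ) (heavyW_nonneg G)
      heavyW_comm X (θ := η * degW G b) (by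
        rw [← hsum, hXc]
        calc 2 * (η * degW G b) * degW G b = ε * degW G b ^ 2 := by rw [hη]; ring
          _ < _ := hb)
    refine honeycombGraph_isContained_of_heavy hk hM.ge hδ hdeg hL0 hη0 Y hYne (hdeg b) ?_ hY ?_
    · rw [← hXc]
      exact_mod_cast Finset.card_le_card hYX
    · rw [← hκ]
      have e : κ * (2 * M * (1 / (η * L) + 1 / (η ^ 2 * L))) = (L - 1) / L := by
        rw [hL]; field_simp; ring
      rw [e, div_lt_one hL0]
      linarith

theorem sum_adjW_eq {V : Type*} [Fintype V] (G : SimpleGraph V) [DecidableRel G.Adj] :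
    ∑ x, ∑ y, adjW G x y = 2 * (G.edgeFinset.card : ℝ) := by
  classical
  have h : ∀ x, ∑ y, adjW G x y = G.degree x := by
    intro x
    rw [← SimpleGraph.card_neighborFinset_eq_degree, SimpleGraph.neighborFinset_eq_filter,
      Finset.card_filter]
    push_cast
    refine Finset.sum_congr rfl fun y _ => ?_
    rw [adjW]
    congr
  simp only [h]
  exact_mod_cast G.sum_degrees_eq_twice_card_edges

theorem exists_extremalNumber_honeycombGraph_le {k : ℕ} (ℓ : ℕ) (hk : Odd k) :
    ∃ C : ℝ, ∀ n : ℕ, (SimpleGraph.extremalNumber n (honeycombGraph k ℓ) : ℝ)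
      ≤ C * (n : ℝ) ^ (4 / 3 : ℝ) := by
  classical
  obtain ⟨C, hC0, hC⟩ := honeycombGraph_isContained_of_minDegree ℓ hk
  refine ⟨2 * (C + 1), fun n => ?_⟩
  have := (SimpleGraph.extremalNumber_le_iff_of_nonneg (V := Fin n) (honeycombGraph k ℓ)
    (m := 2 * (C + 1) * (n : ℝ) ^ (4 / 3 : ℝ)) (by positivity))
  rw [Fintype.card_fin] at this
  rw [this]
  intro G _ hfree
  by_contra hlt
  push Not at hlt
  apply hfree
  set e : ℝ := (G.edgeFinset.card : ℝ) with he
  have hn : 0 < n := by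
    rcases Nat.eq_zero_or_pos n with rfl | h
    · exfalso
      have : G.edgeFinset = ∅ := by
        ext x
        induction x with | _ a b => exact a.elim0
      rw [he, this] at hlt
      simp at hlt
    · exact h
  have hn' : (0 : ℝ) < n := by exact_mod_cast hn
  have he0 : 0 < e := lt_of_le_of_lt (by positivity) hlt
  -- Half the average degree would be `e / n`; the smaller `e / (2 * n)` makes the inequality
  -- strict. Excess over `2 * (C + 1) * n ^ (4/3)` edges then gives minimum degree at least `(C + 1)
  -- * n ^ (1/3)`.
  obtain ⟨Y, -, ⟨y₀, hy₀⟩, hY⟩ := exists_subset_degree_ge (adjW G) (adjW_nonneg G) (adjW_comm G)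
    Finset.univ (θ := e / (2 * n)) (by
      rw [sum_adjW_eq, ← he, Finset.card_univ, Fintype.card_fin]
      have : 2 * (e / (2 * n)) * n = e := by field_simp
      linarith)
  have : Nonempty (Y : Set (Fin n)) := ⟨⟨y₀, hy₀⟩⟩
  refine (hC (Y : Set (Fin n)) (G.induce (Y : Set (Fin n))) (e / (2 * n)) (by positivity)
    ?_ ?_).trans ⟨SimpleGraph.Copy.induce G _⟩
  · rintro ⟨x, hx⟩
    refine (hY x hx).trans (le_of_eq ?_)
    rw [degW, ← Finset.sum_coe_sort]
    refine Finset.sum_congr rfl fun y _ => ?_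
    rw [adjW, adjW]
    rfl
  · have hcard : (Fintype.card (Y : Set (Fin n)) : ℝ) ≤ n := by
      have := Fintype.card_le_of_injective (fun y : (Y : Set (Fin n)) => (y : Fin n))
        Subtype.val_injective
      rw [Fintype.card_fin] at this
      exact_mod_cast this
    have h1 : (C + 1) * (n : ℝ) ^ (1 / 3 : ℝ) ≤ e / (2 * n) := by
      rw [le_div_iff₀ (by positivity)]
      refine le_trans (le_of_eq ?_) hlt.le
      have : (n : ℝ) ^ (4 / 3 : ℝ) = (n : ℝ) ^ (1 / 3 : ℝ) * n := by
        rw [← Real.rpow_add_one hn'.ne']; norm_num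
      rw [this]; ring
    have h2 : ((n : ℝ) ^ (1 / 3 : ℝ)) ^ 3 = n := by
      rw [← Real.rpow_natCast, ← Real.rpow_mul hn'.le]; norm_num
    calc C * Fintype.card (Y : Set (Fin n)) ≤ C * n := by gcongr
      _ ≤ (C + 1) ^ 3 * n := by
          refine mul_le_mul_of_nonneg_right ?_ hn'.le
          nlinarith [sq_nonneg C, pow_pos hC0 3]
      _ = ((C + 1) * (n : ℝ) ^ (1 / 3 : ℝ)) ^ 3 := by rw [mul_pow, h2]
      _ ≤ _ := by gcongr

/-! ### The lower bound: hexagon-free incidence graphs. -/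

/-- Six consecutive vertices of a closed walk of length six without repeated vertices
in the same part. -/
def HasHexagon {V : Type*} (G : SimpleGraph V) : Prop :=
  ∃ v₀ v₁ v₂ v₃ v₄ v₅, G.Adj v₀ v₁ ∧ G.Adj v₁ v₂ ∧ G.Adj v₂ v₃ ∧ G.Adj v₃ v₄ ∧ G.Adj v₄ v₅ ∧
    G.Adj v₅ v₀ ∧ v₀ ≠ v₂ ∧ v₂ ≠ v₄ ∧ v₄ ≠ v₀ ∧ v₁ ≠ v₃ ∧ v₃ ≠ v₅ ∧ v₅ ≠ v₁

theorem HasHexagon.of_copy {V W : Type*} {H : SimpleGraph W} {G : SimpleGraph V}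
    (h : HasHexagon H) (f : SimpleGraph.Copy H G) : HasHexagon G := by
  obtain ⟨v₀, v₁, v₂, v₃, v₄, v₅, h1, h2, h3, h4, h5, h6, n1, n2, n3, n4, n5, n6⟩ := h
  have hf := f.injective
  exact ⟨f v₀, f v₁, f v₂, f v₃, f v₄, f v₅, f.toHom.map_adj h1, f.toHom.map_adj h2,
    f.toHom.map_adj h3, f.toHom.map_adj h4, f.toHom.map_adj h5, f.toHom.map_adj h6,
    hf.ne n1, hf.ne n2, hf.ne n3, hf.ne n4, hf.ne n5, hf.ne n6⟩

theorem HasHexagon.of_map {V W : Type*} {G : SimpleGraph V} (e : V ↪ W)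
    (h : HasHexagon (G.map e)) : HasHexagon G := by
  obtain ⟨v₀, v₁, v₂, v₃, v₄, v₅, h1, h2, h3, h4, h5, h6, n1, n2, n3, n4, n5, n6⟩ := h
  rw [SimpleGraph.map_adj] at h1 h2 h3 h4 h5 h6
  obtain ⟨a₀, a₁, h1, rfl, rfl⟩ := h1
  obtain ⟨b₁, a₂, h2, hb, rfl⟩ := h2
  obtain rfl := e.injective hb
  obtain ⟨b₂, a₃, h3, hb, rfl⟩ := h3
  obtain rfl := e.injective hb
  obtain ⟨b₃, a₄, h4, hb, rfl⟩ := h4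
  obtain rfl := e.injective hb
  obtain ⟨b₄, a₅, h5, hb, rfl⟩ := h5
  obtain rfl := e.injective hb
  obtain ⟨b₅, b₀, h6, hb, hb'⟩ := h6
  obtain rfl := e.injective hb
  obtain rfl := e.injective hb'
  exact ⟨_, _, _, _, _, _, h1, h2, h3, h4, h5, h6, fun h => n1 (by rw [h]), fun h => n2 (by rw [h]),
    fun h => n3 (by rw [h]), fun h => n4 (by rw [h]), fun h => n5 (by rw [h]),
    fun h => n6 (by rw [h])⟩

/-- The hexagon uses rows `1, 2` and columns `1, 2, 3`. Row `k` is not reached, and `x_{1,2}` is the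
only label of `v` among them, so nothing is identified. -/
theorem hasHexagon_honeycombGraph {k ℓ : ℕ} (hk : 3 ≤ k) (hℓ : 4 ≤ ℓ) :
    HasHexagon (honeycombGraph k ℓ) := by
  let x : (i j : ℕ) → 1 ≤ i ∧ i ≤ 2 ∧ 1 ≤ j ∧ j ≤ 3 → HoneycombIndex k ℓ := fun i j h =>
    ⟨(i, j), by simp only [Finset.mem_product, Finset.mem_Icc]; omega⟩
  let y : (i j : ℕ) → 1 ≤ i ∧ i ≤ 2 ∧ 1 ≤ j ∧ j ≤ 3 → HoneycombVertex k ℓ := fun i j h =>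
    Quotient.mk (honeycombSetoid k ℓ) (x i j h)
  have hne : ∀ i j h i' j' h', (i, j) ≠ (i', j') → ¬ (i = 1 ∧ Even j ∧ i' = 1 ∧ Even j') →
      y i j h ≠ y i' j' h' := by
    intro i j h i' j' h' hne hv heq
    have : _ ∨ (i = k ∧ Odd j ∧ i' = k ∧ Odd j') ∨ (i = 1 ∧ Even j ∧ i' = 1 ∧ Even j') :=
      Quotient.exact heq
    rcases this with h1 | h1 | h1
    · exact hne (congrArg Subtype.val h1)
    · omega
    · exact hv h1
  have hadj : ∀ i j h i' j' h', (i, j) ≠ (i', j') → ¬ (i = 1 ∧ Even j ∧ i' = 1 ∧ Even j') →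
      ((i' = i ∧ j' = j + 1) ∨ (i' = i + 1 ∧ j' = j ∧ Odd i ∧ Odd j) ∨
        (i' = i + 1 ∧ j' = j ∧ Even i ∧ Even j)) →
      (honeycombGraph k ℓ).Adj (y i j h) (y i' j' h') := by
    intro i j h i' j' h' h1 h2 h3
    rw [honeycombGraph, SimpleGraph.fromRel_adj]
    exact ⟨hne i j h i' j' h' h1 h2, Or.inl ⟨x i j h, x i' j' h', h3, rfl, rfl⟩⟩
  have p11 : 1 ≤ 1 ∧ 1 ≤ 2 ∧ 1 ≤ 1 ∧ 1 ≤ 3 := by decide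
  have p12 : 1 ≤ 1 ∧ 1 ≤ 2 ∧ 1 ≤ 2 ∧ 2 ≤ 3 := by decide
  have p13 : 1 ≤ 1 ∧ 1 ≤ 2 ∧ 1 ≤ 3 ∧ 3 ≤ 3 := by decide
  have p21 : 1 ≤ 2 ∧ 2 ≤ 2 ∧ 1 ≤ 1 ∧ 1 ≤ 3 := by decide
  have p22 : 1 ≤ 2 ∧ 2 ≤ 2 ∧ 1 ≤ 2 ∧ 2 ≤ 3 := by decide
  have p23 : 1 ≤ 2 ∧ 2 ≤ 2 ∧ 1 ≤ 3 ∧ 3 ≤ 3 := by decide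
  exact ⟨y 1 2 p12, y 1 1 p11, y 2 1 p21, y 2 2 p22, y 2 3 p23, y 1 3 p13,
    (hadj 1 1 p11 1 2 p12 (by decide) (by decide) (by decide)).symm,
    hadj 1 1 p11 2 1 p21 (by decide) (by decide) (by decide),
    hadj 2 1 p21 2 2 p22 (by decide) (by decide) (by decide),
    hadj 2 2 p22 2 3 p23 (by decide) (by decide) (by decide),
    (hadj 1 3 p13 2 3 p23 (by decide) (by decide) (by decide)).symm,
    (hadj 1 2 p12 1 3 p13 (by decide) (by decide) (by decide)).symm,
    hne 1 2 p12 2 1 p21 (by decide) (by decide), hne 2 1 p21 2 3 p23 (by decide) (by decide),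
    hne 2 3 p23 1 2 p12 (by decide) (by decide), hne 1 1 p11 2 2 p22 (by decide) (by decide),
    hne 2 2 p22 1 3 p13 (by decide) (by decide), hne 1 3 p13 1 1 p11 (by decide) (by decide)⟩

/-- The points and lines of the algebraic incidence graph over a field. -/
abbrev IncidenceVertex (F : Type*) : Type _ := (F × F × F) ⊕ (F × F × F)

/-- The incidences `p₂ + l₂ = p₁ l₁`, `p₃ + l₃ = p₁² l₁`. -/
def AlgIncident {F : Type*} [Field F] (p l : F × F × F) : Prop :=
  p.2.1 + l.2.1 = p.1 * l.1 ∧ p.2.2 + l.2.2 = p.1 ^ 2 * l.1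

/-- A bipartite graph with `2 q³` vertices, `q⁴` edges and no hexagon. -/
def algGraph (F : Type*) [Field F] : SimpleGraph (IncidenceVertex F) where
  Adj
    | .inl p, .inr l => AlgIncident p l
    | .inr l, .inl p => AlgIncident p l
    | _, _ => False
  symm := ⟨by rintro (p | p) (l | l) h <;> exact h⟩
  loopless := ⟨by rintro (p | p) h <;> exact h⟩

section Alg

variable {F : Type*} [Field F]

theorem AlgIncident.point_eq {p p' l : F × F × F} (h : AlgIncident p l) (h' : AlgIncident p' l)
    (h1 : p.1 = p'.1) : p = p' := by
  obtain ⟨p1, p2, p3⟩ := p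
  obtain ⟨q1, q2, q3⟩ := p'
  obtain ⟨a, b⟩ := h
  obtain ⟨a', b'⟩ := h'
  simp only at h1 a b a' b'
  subst h1
  rw [← a'] at a
  rw [← b'] at b
  rw [add_right_cancel a, add_right_cancel b]

theorem AlgIncident.line_eq {p l l' : F × F × F} (h : AlgIncident p l) (h' : AlgIncident p l')
    (h1 : l.1 = l'.1) : l = l' := by
  obtain ⟨l1, l2, l3⟩ := l
  obtain ⟨m1, m2, m3⟩ := l'
  obtain ⟨a, b⟩ := h
  obtain ⟨a', b'⟩ := h'
  simp only at h1 a b a' b'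
  subst h1
  rw [← a'] at a
  rw [← b'] at b
  rw [add_left_cancel a, add_left_cancel b]

theorem no_hexagon_of_algIncident {p₀ p₂ p₄ l₁ l₃ l₅ : F × F × F} (h01 : AlgIncident p₀ l₁)
    (h21 : AlgIncident p₂ l₁) (h23 : AlgIncident p₂ l₃) (h43 : AlgIncident p₄ l₃)
    (h45 : AlgIncident p₄ l₅) (h05 : AlgIncident p₀ l₅) (n1 : p₀ ≠ p₂) (n2 : p₄ ≠ p₀)
    (n3 : l₅ ≠ l₁) : False := by
  have e1 : p₀.1 - p₂.1 ≠ 0 := fun h => n1 (h01.point_eq h21 (sub_eq_zero.1 h))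
  have e2 : p₄.1 - p₀.1 ≠ 0 := fun h => n2 (h45.point_eq h05 (sub_eq_zero.1 h))
  have e3 : l₅.1 - l₁.1 ≠ 0 := fun h => n3 (h05.line_eq h01 (sub_eq_zero.1 h))
  refine mul_ne_zero (mul_ne_zero e1 e2) e3 ?_
  obtain ⟨a1, b1⟩ := h01
  obtain ⟨a2, b2⟩ := h21
  obtain ⟨a3, b3⟩ := h23
  obtain ⟨a4, b4⟩ := h43
  obtain ⟨a5, b5⟩ := h45
  obtain ⟨a6, b6⟩ := h05
  -- Alternating sums around the hexagon eliminate the second and third coordinates. The weight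
  -- `p₂.1 + p₄.1` then eliminates `l₃.1`, and what remains is the product of `e1`, `e2`, `e3`.
  linear_combination
    (p₂.1 + p₄.1) * (a1 - a2 + a3 - a4 + a5 - a6) - (b1 - b2 + b3 - b4 + b5 - b6)

theorem not_hasHexagon_algGraph : ¬ HasHexagon (algGraph F) := by
  rintro ⟨v₀, v₁, v₂, v₃, v₄, v₅, h1, h2, h3, h4, h5, h6, n1, n2, n3, n4, n5, n6⟩
  rcases v₀ with v₀ | v₀ <;> rcases v₁ with v₁ | v₁ <;> first | exact h1.elim | skip
  all_goals rcases v₂ with v₂ | v₂ <;> first | exact h2.elim | skip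
  all_goals rcases v₃ with v₃ | v₃ <;> first | exact h3.elim | skip
  all_goals rcases v₄ with v₄ | v₄ <;> first | exact h4.elim | skip
  all_goals rcases v₅ with v₅ | v₅ <;> first | exact h5.elim | skip
  · exact no_hexagon_of_algIncident (p₀ := v₀) (p₂ := v₂) (p₄ := v₄) (l₁ := v₁) (l₃ := v₃) (l₅ := v₅)
      h1 h2 h3 h4 h5 h6 (by simpa using n1) (by simpa using n3) (by simpa using n6)
  · exact no_hexagon_of_algIncident (p₀ := v₁) (p₂ := v₃) (p₄ := v₅) (l₁ := v₂) (l₃ := v₄) (l₅ := v₀)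
      h2 h3 h4 h5 h6 h1 (by simpa using n4) (by simpa using n6) (by simpa using n1)

theorem card_edgeFinset_algGraph_ge [Fintype F] [DecidableEq F] [Fintype (algGraph F).edgeSet] :
    Fintype.card F ^ 4 ≤ (algGraph F).edgeFinset.card := by
  -- A point and the first coordinate of a line determine the line through the incidence equations.
  let g : F × F × F × F → (algGraph F).edgeSet := fun t =>
    ⟨s(.inl (t.1, t.2.1, t.2.2.1), .inr (t.2.2.2, t.1 * t.2.2.2 - t.2.1,
      t.1 ^ 2 * t.2.2.2 - t.2.2.1)), by
      rw [SimpleGraph.mem_edgeSet]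
      constructor <;> simp⟩
  have hg : Function.Injective g := by
    rintro ⟨a, b, c, d⟩ ⟨a', b', c', d'⟩ h
    have := congrArg Subtype.val h
    simp only [g, Sym2.eq_iff, Sum.inl.injEq, Sum.inr.injEq, Prod.mk.injEq, reduceCtorEq,
      false_and, or_false] at this
    simp only [Prod.mk.injEq]
    tauto
  have := Fintype.card_le_of_injective g hg
  rw [← SimpleGraph.edgeFinset_card] at this
  refine le_trans (le_of_eq ?_) this
  simp only [Fintype.card_prod]
  ring

end Alg

theorem le_extremalNumber_of_hasHexagon {W : Type*} {H : SimpleGraph W} (hH : HasHexagon H)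
    (F : Type*) [Field F] [Fintype F] {n : ℕ} (hn : 2 * Fintype.card F ^ 3 ≤ n) :
    Fintype.card F ^ 4 ≤ SimpleGraph.extremalNumber n H := by
  classical
  have hcard : Fintype.card (IncidenceVertex F) ≤ Fintype.card (Fin n) := by
    simp only [Fintype.card_sum, Fintype.card_prod, Fintype.card_fin]
    calc _ = 2 * Fintype.card F ^ 3 := by ring
      _ ≤ n := hn
  obtain ⟨e⟩ := Function.Embedding.nonempty_of_card_le hcard
  have hfree : H.Free ((algGraph F).map e) := by
    rintro ⟨f⟩
    exact not_hasHexagon_algGraph ((hH.of_copy f).of_map e)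
  have h1 := SimpleGraph.card_edgeFinset_le_extremalNumber hfree
  rw [Fintype.card_fin, SimpleGraph.card_edgeFinset_map] at h1
  exact card_edgeFinset_algGraph_ge.trans h1

theorem le_extremalNumber_rpow_of_hasHexagon {W : Type*} {H : SimpleGraph W} (hH : HasHexagon H)
    {n : ℕ} (hn : 16 ≤ n) :
    (n : ℝ) ^ (4 / 3 : ℝ) ≤ (16 : ℝ) ^ (4 / 3 : ℝ) * SimpleGraph.extremalNumber n H := by
  -- Bertrand's postulate gives a prime `p` with `y ≤ p ≤ 2 * y`; the `16` is forced by `2 * (2 * y)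
  -- ^ 3 = n`.
  set y : ℝ := ((n : ℝ) / 16) ^ (1 / 3 : ℝ) with hy
  have hn' : (16 : ℝ) ≤ n := by exact_mod_cast hn
  have hq0 : (0 : ℝ) ≤ (n : ℝ) / 16 := by positivity
  have hy0 : 0 ≤ y := by positivity
  have hy3 : y ^ 3 = n / 16 := by
    rw [hy, ← Real.rpow_natCast, ← Real.rpow_mul hq0]; norm_num
  have hy1 : 1 ≤ y := by
    rw [hy]
    exact Real.one_le_rpow (by linarith) (by norm_num)
  have hm : ⌊y⌋₊ ≠ 0 := (Nat.floor_pos.2 hy1).ne'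
  obtain ⟨p, hp, hmp, hpm⟩ := Nat.exists_prime_lt_and_le_two_mul ⌊y⌋₊ hm
  have := Fact.mk hp
  have hpy : y ≤ p := (Nat.lt_floor_add_one y).le.trans (by exact_mod_cast hmp)
  have hp3 : 2 * p ^ 3 ≤ n := by
    have : (p : ℝ) ≤ 2 * y := by
      calc (p : ℝ) ≤ 2 * ⌊y⌋₊ := by exact_mod_cast hpm
        _ ≤ 2 * y := by have := Nat.floor_le hy0; linarith
    have : 2 * (p : ℝ) ^ 3 ≤ (n : ℝ) := by
      calc 2 * (p : ℝ) ^ 3 ≤ 2 * (2 * y) ^ 3 := by gcongr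
        _ = (n : ℝ) := by rw [mul_pow, hy3]; ring
    exact_mod_cast this
  have hp4 : ((p : ℝ)) ^ 4 ≤ SimpleGraph.extremalNumber n H := by
    have := le_extremalNumber_of_hasHexagon hH (ZMod p) (n := n) (by rwa [ZMod.card])
    rw [ZMod.card] at this
    exact_mod_cast this
  calc (n : ℝ) ^ (4 / 3 : ℝ) = (16 : ℝ) ^ (4 / 3 : ℝ) * ((n : ℝ) / 16) ^ (4 / 3 : ℝ) := by
        rw [← Real.mul_rpow (by norm_num) hq0]; congr 1; ring
    _ = (16 : ℝ) ^ (4 / 3 : ℝ) * y ^ 4 := by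
        rw [hy, ← Real.rpow_natCast, ← Real.rpow_mul hq0]; norm_num
    _ ≤ _ := by
        refine mul_le_mul_of_nonneg_left ?_ (by positivity)
        exact le_trans (by gcongr) hp4

theorem theorem2 (k ℓ : ℕ) (hk : Odd k) (hℓ : Even ℓ) (hℓ2 : 2 ≤ ℓ) :
    ((fun n : ℕ => (SimpleGraph.extremalNumber n (honeycombGraph k ℓ) : ℝ))
      =O[atTop] fun n : ℕ => (n : ℝ) ^ (4 / 3 : ℝ)) ∧
    (3 ≤ k → 4 ≤ ℓ →
      (fun n : ℕ => (SimpleGraph.extremalNumber n (honeycombGraph k ℓ) : ℝ))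
        =Θ[atTop] fun n : ℕ => (n : ℝ) ^ (4 / 3 : ℝ)) := by
  have hO : (fun n : ℕ => (SimpleGraph.extremalNumber n (honeycombGraph k ℓ) : ℝ))
      =O[atTop] fun n : ℕ => (n : ℝ) ^ (4 / 3 : ℝ) := by
    obtain ⟨C, hC⟩ := exists_extremalNumber_honeycombGraph_le ℓ hk
    refine IsBigO.of_bound C (Eventually.of_forall fun n => ?_)
    rw [Real.norm_of_nonneg (Nat.cast_nonneg _), Real.norm_of_nonneg (by positivity)]
    exact hC n
  refine ⟨hO, fun hk3 hℓ4 => ⟨hO, ?_⟩⟩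
  refine IsBigO.of_bound ((16 : ℝ) ^ (4 / 3 : ℝ)) ?_
  filter_upwards [eventually_ge_atTop 16] with n hn
  rw [Real.norm_of_nonneg (Nat.cast_nonneg _), Real.norm_of_nonneg (by positivity)]
  exact le_extremalNumber_rpow_of_hasHexagon (hasHexagon_honeycombGraph hk3 hℓ4) hn
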